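/- There is a $\Delta^0_3$ set $G \subseteq \mathbb{N}$ such that the principal Turing ideal $\langle G\rangle = \{S \subseteq \mathbb{N} : S \leq_T G\}$ is not $n$-generically-coded for any $n \geq 3$; that is, for every $n \geq 3$ some $n$-$\langle G\rangle$-generic set does not compute $G$. This holds for every choice of an exact pair for $\langle G\rangle$ (in particular for the pair $G, G$). Here a Turing ideal $\mathcal{I}$ is a collection of subsets of $\mathbb{N}$ closed under $\leq_T$ and $\oplus$, always considered together with a chosen exact pair, i.e. sets $A_0, A_1$ such that $S \in \mathcal{I}$ if and only if $S \leq_T A_0$ and $S \leq_T A_1$. An $\mathcal{I}$-condition is a pair $(D,S)$ with $D \subseteq \mathbb{N}$ finite, $S \in \mathcal{I}$ infinite, and $\max D < \min S$. It is extended by $(D',S')$ if $D \subseteq D' \subseteq D \cup S$ and $S' \subseteq S$, and a set $A$ satisfies it if $D \subseteq A \subseteq D \cup S$. An index of $(D,S)$ is a triple $\langle d, e_0, e_1\rangle$ where $d$ is the canonical index of $D$ and $\Phi_{e_0}^{A_0} = \Phi_{e_1}^{A_1} = S$. A collection $\mathcal{C}$ of $\mathcal{I}$-conditions is $\Sigma^0_n(\mathcal{I})$-definable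 if, for some $\Sigma^0_n(A_0 \oplus A_1)$ set $W$ of numbers, it consists of exactly the $\mathcal{I}$-conditions that have an index in $W$. A set $H$ is $n$-$\mathcal{I}$-generic if for every $\Sigma^0_n(\mathcal{I})$-definable collection $\mathcal{C}$ of $\mathcal{I}$-conditions, $H$ satisfies either a condition in $\mathcal{C}$ or an $\mathcal{I}$-condition with no extension in $\mathcal{C}$. The ideal $\mathcal{I}$ is $n$-generically-coded if every $n$-$\mathcal{I}$-generic set computes every $A \in \mathcal{I}$. -/

import Mathlib

open Classical in
/-- The characteristic function of a set of natural numbers, as an oracle. -/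
noncomputable def charFun (A : Set ℕ) : ℕ →. ℕ :=
  fun n => Part.some (if n ∈ A then 1 else 0)

/-- `A ≤ₛ B`: the set `A` is Turing reducible to (computable from) the set `B`. -/
def SetReducible (A B : Set ℕ) : Prop :=
  TuringReducible (charFun A) (charFun B)

infix:50 " ≤ₛ " => SetReducible

/-- The join `A ⊕ B = {2n : n ∈ A} ∪ {2n + 1 : n ∈ B}`. -/
def setJoin (A B : Set ℕ) : Set ℕ :=
  {m | (m % 2 = 0 ∧ m / 2 ∈ A) ∨ (m % 2 = 1 ∧ m / 2 ∈ B)}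

/-! ### The arithmetical hierarchy relative to an oracle -/

/-- `IsSigma X n P`: the set `P` is `Σ⁰ₙ(X)`.  The level `0` consists of the `X`-computable sets,
and `P` is `Σ⁰ₙ₊₁(X)` when `x ∈ P ↔ ∃ y, ⟨x, y⟩ ∉ Q` for some `Σ⁰ₙ(X)` set `Q`. -/
def IsSigma (X : Set ℕ) : ℕ → Set ℕ → Prop
  | 0, P => P ≤ₛ X
  | n + 1, P => ∃ Q : Set ℕ, IsSigma X n Q ∧ ∀ x, x ∈ P ↔ ∃ y, Nat.pair x y ∉ Q

/-- `P` is `Δ⁰ₙ(X)`: both `P` and its complement are `Σ⁰ₙ(X)`. -/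
def IsDelta (X : Set ℕ) (n : ℕ) (P : Set ℕ) : Prop :=
  IsSigma X n P ∧ IsSigma X n Pᶜ

/-! ### Turing functionals and their indices -/

open Classical in
/-- The initial segment of (the characteristic sequence of) `A` of length `k`. -/
noncomputable def initSeg (A : Set ℕ) (k : ℕ) : List Bool :=
  (List.range k).map fun i => decide (i ∈ A)

/-- `Φ_e^A(x)`, the `e`-th Turing functional with oracle `A` on input `x`: search for the least
`t = ⟨s, k⟩` such that the `e`-th program halts within `s` steps on the initial segment of `A` of
length `k` together with `x`, and return its output. -/
noncomputable def turingFunctional (e : ℕ) (A : Set ℕ) (x : ℕ) : Part ℕ :=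
  Nat.rfindOpt fun t =>
    Nat.Partrec.Code.evaln t.unpair.1 (Denumerable.ofNat Nat.Partrec.Code e)
      (Nat.pair (Encodable.encode (initSeg A t.unpair.2)) x)

/-! ### The numbering is complete -/

/-- Stagewise computations: `h k σ x` is the result, if any, of `k` stages with the finite oracle
`σ` on input `x`.  They grow with `k` and `σ`, and represent `f` over the oracle `A`. -/
structure StageRep (A : Set ℕ) (f : ℕ →. ℕ) (h : ℕ × List Bool × ℕ → Option ℕ) : Prop where
  prim : Primrec h
  mono : ∀ k k' σ σ' x y, k ≤ k' → σ <+: σ' → h (k, σ, x) = some y → h (k', σ', x) = some y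
  spec : ∀ x y, y ∈ f x ↔ ∃ k, h (k, initSeg A k, x) = some y

theorem initSeg_prefix (A : Set ℕ) {k k' : ℕ} (hk : k ≤ k') : initSeg A k <+: initSeg A k' := by
  obtain ⟨d, rfl⟩ := Nat.exists_eq_add_of_le hk
  simp [initSeg, List.range_add]

theorem initSeg_length (A : Set ℕ) (k : ℕ) : (initSeg A k).length = k := by
  simp [initSeg]

theorem StageRep.up {A f h} (H : StageRep A f h) {k k' x y} (hk : k ≤ k')
    (hy : h (k, initSeg A k, x) = some y) : h (k', initSeg A k', x) = some y :=
  H.mono _ _ _ _ _ _ hk (initSeg_prefix A hk) hy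

theorem StageRep.ofTotal {A : Set ℕ} {f : ℕ → ℕ} (hf : Primrec f) :
    StageRep A (fun n => Part.some (f n)) (fun p => some (f p.2.2)) where
  prim := Primrec.option_some.comp (hf.comp (Primrec.snd.comp Primrec.snd))
  mono := by intros; simp_all
  spec := by intro x y; simp [eq_comm]

open Classical in
theorem StageRep.oracle (A : Set ℕ) :
    StageRep A (charFun A) (fun p => (p.2.1[p.2.2]?).map fun b => cond b 1 0) where
  prim := by
    refine Primrec.option_map (Primrec.list_getElem?.comp (Primrec.fst.comp Primrec.snd)
      (Primrec.snd.comp Primrec.snd)) ?_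
    exact Primrec.cond Primrec.snd (Primrec.const 1) (Primrec.const 0)
  mono := by
    intro k k' σ σ' x y _ hσ hy
    obtain ⟨τ, rfl⟩ := hσ
    simp only [Option.map_eq_some_iff] at hy ⊢
    obtain ⟨b, hb, rfl⟩ := hy
    refine ⟨b, ?_, rfl⟩
    rw [List.getElem?_append_left]
    · exact hb
    · exact (List.getElem?_eq_some_iff.1 hb).1
  spec := by
    intro x y
    have key : ∀ k, x < k → (initSeg A k)[x]? = some (decide (x ∈ A)) := by
      intro k hk
      simp [initSeg, hk]
    constructor
    · intro hy
      refine ⟨x + 1, ?_⟩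
      rw [key _ (Nat.lt_succ_self x)]
      simp only [charFun, Part.mem_some_iff] at hy
      subst hy
      by_cases hx : x ∈ A <;> simp [hx]
    · rintro ⟨k, hk⟩
      simp only [Option.map_eq_some_iff] at hk
      obtain ⟨b, hb, rfl⟩ := hk
      have hlt := (List.getElem?_eq_some_iff.1 hb).1
      rw [initSeg_length] at hlt
      rw [key _ hlt] at hb
      have hb : decide (x ∈ A) = b := Option.some.inj hb
      subst hb
      by_cases hx : x ∈ A <;> simp [charFun, hx]

theorem StageRep.pair {A f g h₁ h₂} (H₁ : StageRep A f h₁) (H₂ : StageRep A g h₂) :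
    StageRep A (fun n => Nat.pair <$> f n <*> g n)
      (fun p => (h₁ p).bind fun a => (h₂ p).map fun b => Nat.pair a b) where
  prim := by
    refine Primrec.option_bind H₁.prim ?_
    refine Primrec.option_map (H₂.prim.comp Primrec.fst) ?_
    exact Primrec₂.natPair.comp (Primrec.snd.comp Primrec.fst) Primrec.snd
  mono := by
    intro k k' σ σ' x y hk hσ hy
    simp only [Option.bind_eq_some_iff, Option.map_eq_some_iff] at hy ⊢
    obtain ⟨a, ha, b, hb, rfl⟩ := hy
    exact ⟨a, H₁.mono _ _ _ _ _ _ hk hσ ha, b, H₂.mono _ _ _ _ _ _ hk hσ hb, rfl⟩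
  spec := by
    intro x y
    simp only [Seq.seq, Part.map_eq_map, Part.mem_bind_iff, Part.mem_map_iff,
      exists_exists_and_eq_and, Option.bind_eq_some_iff, Option.map_eq_some_iff, H₁.spec, H₂.spec]
    constructor
    · rintro ⟨a, ⟨k, ha⟩, b, ⟨l, hb⟩, rfl⟩
      exact ⟨max k l, a, H₁.up (le_max_left _ _) ha, b, H₂.up (le_max_right _ _) hb, rfl⟩
    · rintro ⟨k, a, ha, b, hb, rfl⟩
      exact ⟨a, ⟨k, ha⟩, b, ⟨k, hb⟩, rfl⟩

theorem StageRep.comp {A f g h₁ h₂} (H₁ : StageRep A f h₁) (H₂ : StageRep A g h₂) :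
    StageRep A (fun n => g n >>= f)
      (fun p => (h₂ p).bind fun a => h₁ (p.1, p.2.1, a)) where
  prim := by
    refine Primrec.option_bind H₂.prim ?_
    exact H₁.prim.comp (Primrec.pair (Primrec.fst.comp Primrec.fst)
      (Primrec.pair (Primrec.fst.comp (Primrec.snd.comp Primrec.fst)) Primrec.snd))
  mono := by
    intro k k' σ σ' x y hk hσ hy
    simp only [Option.bind_eq_some_iff] at hy ⊢
    obtain ⟨a, ha, hb⟩ := hy
    exact ⟨a, H₂.mono _ _ _ _ _ _ hk hσ ha, H₁.mono _ _ _ _ _ _ hk hσ hb⟩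
  spec := by
    intro x y
    change y ∈ (g x).bind (fun z => f z) ↔ _
    simp only [Part.mem_bind_iff, Option.bind_eq_some_iff, H₁.spec, H₂.spec]
    constructor
    · rintro ⟨a, ⟨k, ha⟩, ⟨l, hb⟩⟩
      exact ⟨max k l, a, H₂.up (le_max_left _ _) ha, H₁.up (le_max_right _ _) hb⟩
    · rintro ⟨k, a, ha, hb⟩
      exact ⟨a, ⟨k, ha⟩, ⟨k, hb⟩⟩

/-- Stages of a primitive recursion. -/
def precStage (h₁ h₂ : ℕ × List Bool × ℕ → Option ℕ) (p : ℕ × List Bool × ℕ) (a n : ℕ) :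
    Option ℕ :=
  Nat.rec (h₁ (p.1, p.2.1, a))
    (fun y IH => IH.bind fun i => h₂ (p.1, p.2.1, Nat.pair a (Nat.pair y i))) n

theorem StageRep.prec {A f g h₁ h₂} (H₁ : StageRep A f h₁) (H₂ : StageRep A g h₂) :
    StageRep A (fun p => let (a, n) := Nat.unpair p
        n.rec (f a) fun y IH => do
          let i ← IH
          g (Nat.pair a (Nat.pair y i)))
      (fun p => precStage h₁ h₂ p p.2.2.unpair.1 p.2.2.unpair.2) where
  prim := by
    have e1 : Primrec fun p : ℕ × List Bool × ℕ => p.2.2.unpair.1 :=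
      Primrec.fst.comp (Primrec.unpair.comp (Primrec.snd.comp Primrec.snd))
    have e2 : Primrec fun p : ℕ × List Bool × ℕ => p.2.2.unpair.2 :=
      Primrec.snd.comp (Primrec.unpair.comp (Primrec.snd.comp Primrec.snd))
    refine Primrec.nat_rec' (f := fun p : ℕ × List Bool × ℕ => p.2.2.unpair.2)
      (g := fun p => h₁ (p.1, p.2.1, p.2.2.unpair.1))
      (h := fun p q => q.2.bind fun i =>
        h₂ (p.1, p.2.1, Nat.pair p.2.2.unpair.1 (Nat.pair q.1 i))) e2 ?_ ?_
    · exact H₁.prim.comp (Primrec.pair Primrec.fst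
        (Primrec.pair (Primrec.fst.comp Primrec.snd) e1))
    · refine Primrec.option_bind (Primrec.snd.comp Primrec.snd) ?_
      have p0 : Primrec fun z : ((ℕ × List Bool × ℕ) × ℕ × Option ℕ) × ℕ => z.1.1 :=
        Primrec.fst.comp Primrec.fst
      exact H₂.prim.comp (Primrec.pair (Primrec.fst.comp p0)
        (Primrec.pair (Primrec.fst.comp (Primrec.snd.comp p0))
          (Primrec₂.natPair.comp (e1.comp p0) (Primrec₂.natPair.comp
            (Primrec.fst.comp (Primrec.snd.comp Primrec.fst)) Primrec.snd))))
  mono := by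
    intro k k' σ σ' x y hk hσ
    simp only []
    generalize x.unpair.1 = a
    generalize x.unpair.2 = n
    induction n generalizing y with
    | zero => exact H₁.mono _ _ _ _ _ _ hk hσ
    | succ n ih =>
      simp only [precStage, Option.bind_eq_some_iff]
      rintro ⟨i, hi, hy⟩
      exact ⟨i, ih i hi, H₂.mono _ _ _ _ _ _ hk hσ hy⟩
  spec := by
    intro x y
    simp only []
    generalize x.unpair.1 = a
    generalize x.unpair.2 = n
    have up : ∀ n y k k', k ≤ k' → precStage h₁ h₂ (k, initSeg A k, x) a n = some y →
        precStage h₁ h₂ (k', initSeg A k', x) a n = some y := by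
      intro n y k k' hk
      induction n generalizing y with
      | zero => exact H₁.up hk
      | succ n ih =>
        simp only [precStage, Option.bind_eq_some_iff]
        rintro ⟨i, hi, hy⟩
        exact ⟨i, ih i hi, H₂.up hk hy⟩
    induction n generalizing y with
    | zero => exact H₁.spec a y
    | succ n ih =>
      refine Iff.trans Part.mem_bind_iff ?_
      refine Iff.trans (exists_congr fun i => and_congr (ih i) (H₂.spec _ _)) ?_
      constructor
      · rintro ⟨i, ⟨k, hi⟩, l, hy⟩
        refine ⟨max k l, ?_⟩
        have h1 := up _ _ _ _ (le_max_left k l) hi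
        have h2 := H₂.up (le_max_right k l) hy
        simp only [precStage, Option.bind_eq_some_iff]
        exact ⟨i, h1, h2⟩
      · rintro ⟨k, hk⟩
        simp only [precStage, Option.bind_eq_some_iff] at hk
        obtain ⟨i, hi, hy⟩ := hk
        exact ⟨i, ⟨k, hi⟩, k, hy⟩

/-- Stages of an unbounded search: after `m` tests, `some (some y)` means that `y` was found,
`some none` that all tests so far were negative, and `none` that some test did not halt. -/
def rfindStage (h : ℕ × List Bool × ℕ → Option ℕ) (p : ℕ × List Bool × ℕ) (m : ℕ) :
    Option (Option ℕ) :=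
  Nat.rec (some none)
    (fun n IH => IH.bind fun r => Option.casesOn r
      ((h (p.1, p.2.1, Nat.pair p.2.2 n)).map fun v => Nat.casesOn v (some n) fun _ => none)
      (fun y => some (some y))) m

theorem rfindStage_none (h : ℕ × List Bool × ℕ → Option ℕ) (k σ x m) :
    rfindStage h (k, σ, x) m = some none ↔
      ∀ n < m, ∃ v, h (k, σ, Nat.pair x n) = some (v + 1) := by
  induction m with
  | zero => simp [rfindStage]
  | succ m ih =>
    have e : rfindStage h (k, σ, x) (m + 1) = (rfindStage h (k, σ, x) m).bind fun r =>
      Option.casesOn r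
      ((h (k, σ, Nat.pair x m)).map fun v => Nat.casesOn v (some m) fun _ => none)
      (fun y => some (some y)) := rfl
    rw [e]
    constructor
    · intro H
      obtain ⟨r, hr, H⟩ := Option.bind_eq_some_iff.1 H
      cases r with
      | some y => simp at H
      | none =>
        obtain ⟨v, hv, H⟩ := Option.map_eq_some_iff.1 H
        intro n hn
        rcases Nat.lt_succ_iff_lt_or_eq.1 hn with hn | rfl
        · exact ih.1 hr n hn
        · cases v with
          | zero => simp at H
          | succ v => exact ⟨v, hv⟩
    · intro H
      rw [ih.2 fun n hn => H n (hn.trans (Nat.lt_succ_self m))]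
      obtain ⟨v, hv⟩ := H m (Nat.lt_succ_self m)
      simp [hv]

theorem rfindStage_some (h : ℕ × List Bool × ℕ → Option ℕ) (k σ x m y) :
    rfindStage h (k, σ, x) m = some (some y) ↔
      y < m ∧ h (k, σ, Nat.pair x y) = some 0 ∧
        ∀ n < y, ∃ v, h (k, σ, Nat.pair x n) = some (v + 1) := by
  induction m with
  | zero => simp [rfindStage]
  | succ m ih =>
    have e : rfindStage h (k, σ, x) (m + 1) = (rfindStage h (k, σ, x) m).bind fun r =>
      Option.casesOn r
      ((h (k, σ, Nat.pair x m)).map fun v => Nat.casesOn v (some m) fun _ => none)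
      (fun y => some (some y)) := rfl
    rw [e]
    constructor
    · intro H
      obtain ⟨r, hr, H⟩ := Option.bind_eq_some_iff.1 H
      cases r with
      | some z =>
        simp only [Option.some.injEq] at H
        subst H
        obtain ⟨h1, h2⟩ := ih.1 hr
        exact ⟨h1.trans (Nat.lt_succ_self m), h2⟩
      | none =>
        obtain ⟨v, hv, H⟩ := Option.map_eq_some_iff.1 H
        cases v with
        | succ v => simp at H
        | zero =>
          have H : m = y := Option.some.inj H
          subst H
          exact ⟨Nat.lt_succ_self _, hv, (rfindStage_none h k σ x _).1 hr⟩
    · rintro ⟨h1, h2, h3⟩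
      rcases Nat.lt_succ_iff_lt_or_eq.1 h1 with hn | rfl
      · rw [ih.2 ⟨hn, h2, h3⟩]; rfl
      · rw [(rfindStage_none h k σ x _).2 h3]
        simp [h2]

theorem StageRep.rfind {A f h} (H : StageRep A f h) :
    StageRep A (fun a => Nat.rfind fun n => (fun m => m = 0) <$> f (Nat.pair a n))
      (fun p => (rfindStage h p p.1).bind id) where
  prim := by
    refine Primrec.option_bind (f := fun p : ℕ × List Bool × ℕ => rfindStage h p p.1)
      (g := fun _ r => id r) ?_ Primrec.snd
    refine Primrec.nat_rec' (f := fun p : ℕ × List Bool × ℕ => p.1)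
      (g := fun _ => some none)
      (h := fun p q => q.2.bind fun r => Option.casesOn r
        ((h (p.1, p.2.1, Nat.pair p.2.2 q.1)).map fun v => Nat.casesOn v (some q.1) fun _ => none)
        (fun y => some (some y))) Primrec.fst (Primrec.const _) ?_
    refine Primrec.option_bind (Primrec.snd.comp Primrec.snd) ?_
    refine Primrec.option_casesOn Primrec.snd ?_ ?_
    · have p0 : Primrec fun z : ((ℕ × List Bool × ℕ) × ℕ × Option (Option ℕ)) × Option ℕ =>
        z.1.1 := Primrec.fst.comp Primrec.fst
      have p1 : Primrec fun z : ((ℕ × List Bool × ℕ) × ℕ × Option (Option ℕ)) × Option ℕ =>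
        z.1.2.1 := Primrec.fst.comp (Primrec.snd.comp Primrec.fst)
      refine Primrec.option_map (H.prim.comp (Primrec.pair (Primrec.fst.comp p0)
        (Primrec.pair (Primrec.fst.comp (Primrec.snd.comp p0))
          (Primrec₂.natPair.comp (Primrec.snd.comp (Primrec.snd.comp p0)) p1)))) ?_
      exact Primrec.nat_casesOn Primrec.snd (Primrec.option_some.comp (p1.comp Primrec.fst))
        (Primrec.const none).to₂
    · exact (Primrec.option_some.comp (Primrec.option_some.comp Primrec.snd))
  mono := by
    intro k k' σ σ' x y hk hσ hy
    simp only [Option.bind_eq_some_iff, id, exists_eq_right] at hy ⊢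
    rw [rfindStage_some] at hy ⊢
    obtain ⟨h1, h2, h3⟩ := hy
    refine ⟨h1.trans_le hk, H.mono _ _ _ _ _ _ hk hσ h2, fun n hn => ?_⟩
    obtain ⟨v, hv⟩ := h3 n hn
    exact ⟨v, H.mono _ _ _ _ _ _ hk hσ hv⟩
  spec := by
    intro x y
    have hm : ∀ (n : ℕ) (b : Bool), b ∈ ((fun m => decide (m = 0)) <$> f (Nat.pair x n) : Part Bool)
        ↔ ∃ v, (∃ k, h (k, initSeg A k, Nat.pair x n) = some v) ∧ decide (v = 0) = b := by
      intro n b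
      simp only [Part.map_eq_map, Part.mem_map_iff, H.spec]
    simp only [Option.bind_eq_some_iff, id, exists_eq_right, rfindStage_some]
    refine Iff.trans Nat.mem_rfind ?_
    refine Iff.trans (and_congr (hm _ _) (forall_congr' fun n => imp_congr_right fun _ => hm _ _)) ?_
    constructor
    · rintro ⟨⟨v, ⟨k, hk⟩, hv⟩, h2⟩
      have hv : v = 0 := by simpa using hv
      subst hv
      have h3 : ∀ n, ∃ l, n < y → ∃ v, h (l, initSeg A l, Nat.pair x n) = some (v + 1) := by
        intro n
        by_cases hn : n < y
        · obtain ⟨v, ⟨l, hl⟩, hv⟩ := @h2 n hn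
          have hv : v ≠ 0 := by simpa using hv
          obtain ⟨w, rfl⟩ := Nat.exists_eq_succ_of_ne_zero hv
          exact ⟨l, fun _ => ⟨w, hl⟩⟩
        · exact ⟨0, fun h => absurd h hn⟩
      choose l hl using h3
      refine ⟨max (max k (y + 1)) ((Finset.range y).sup l), ?_, ?_, fun n hn => ?_⟩
      · exact lt_of_lt_of_le (Nat.lt_succ_self y) ((le_max_right _ _).trans (le_max_left _ _))
      · exact H.up ((le_max_left _ _).trans (le_max_left _ _)) hk
      · obtain ⟨v, hv⟩ := hl n hn
        exact ⟨v, H.up ((Finset.le_sup (Finset.mem_range.2 hn)).trans (le_max_right _ _)) hv⟩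
    · rintro ⟨k, _, h2, h3⟩
      refine ⟨⟨0, ⟨k, h2⟩, by simp⟩, fun {n} hn => ?_⟩
      obtain ⟨v, hv⟩ := h3 n hn
      exact ⟨v + 1, ⟨k, hv⟩, by simp⟩

theorem exists_stageRep {A : Set ℕ} {f : ℕ →. ℕ} (hf : Nat.RecursiveIn {charFun A} f) :
    ∃ h, StageRep A f h := by
  induction hf with
  | zero => exact ⟨_, StageRep.ofTotal (Primrec.const 0)⟩
  | succ => exact ⟨_, StageRep.ofTotal Primrec.succ⟩
  | left => exact ⟨_, StageRep.ofTotal (Primrec.fst.comp Primrec.unpair)⟩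
  | right => exact ⟨_, StageRep.ofTotal (Primrec.snd.comp Primrec.unpair)⟩
  | oracle g hg => rw [Set.mem_singleton_iff.1 hg]; exact ⟨_, StageRep.oracle A⟩
  | pair _ _ h1 h2 => exact ⟨_, h1.choose_spec.pair h2.choose_spec⟩
  | comp _ _ h1 h2 => exact ⟨_, h1.choose_spec.comp h2.choose_spec⟩
  | prec _ _ h1 h2 => exact ⟨_, h1.choose_spec.prec h2.choose_spec⟩
  | rfind _ h1 => exact ⟨_, h1.choose_spec.rfind⟩

/-- Every partial function that is recursive in `A` is some `Φ_e` with oracle `A`. -/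
theorem exists_turingFunctional {A : Set ℕ} {f : ℕ →. ℕ}
    (hf : TuringReducible f (charFun A)) : ∃ e, turingFunctional e A = f := by
  obtain ⟨h, H⟩ := exists_stageRep (RecursiveIn.iff_nat.1 hf)
  -- the program that decodes the oracle string and runs as many stages as its length
  let g : ℕ →. ℕ := fun z =>
    ((Encodable.decode (α := List Bool) z.unpair.1).bind fun σ => h (σ.length, σ, z.unpair.2) :
      Option ℕ)
  have hg : Partrec g := by
    refine Computable.ofOption (Primrec.to_comp ?_)
    refine Primrec.option_bind (Primrec.decode.comp (Primrec.fst.comp Primrec.unpair)) ?_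
    exact H.prim.comp (Primrec.pair (Primrec.list_length.comp Primrec.snd)
      (Primrec.pair Primrec.snd (Primrec.snd.comp (Primrec.unpair.comp Primrec.fst))))
  obtain ⟨c, hc⟩ := Nat.Partrec.Code.exists_code.1 (Partrec.nat_iff.1 hg)
  have key : ∀ k x y, y ∈ c.eval (Nat.pair (Encodable.encode (initSeg A k)) x) ↔
      h (k, initSeg A k, x) = some y := by
    intro k x y
    rw [hc]
    simp [g, initSeg_length]
  refine ⟨Encodable.encode c, ?_⟩
  have sound : ∀ x y, y ∈ turingFunctional (Encodable.encode c) A x → y ∈ f x := by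
    intro x y hy
    obtain ⟨t, ht⟩ := Nat.rfindOpt_spec hy
    rw [Denumerable.ofNat_encode] at ht
    exact (H.spec x y).2 ⟨_, (key _ _ _).1 (Nat.Partrec.Code.evaln_sound ht)⟩
  funext x
  refine Part.ext fun y => ⟨sound x y, fun hy => ?_⟩
  obtain ⟨k, hk⟩ := (H.spec x y).1 hy
  obtain ⟨s, hs⟩ := Nat.Partrec.Code.evaln_complete.1 ((key _ _ _).2 hk)
  have hd : (turingFunctional (Encodable.encode c) A x).Dom := by
    refine Nat.rfindOpt_dom.2 ⟨Nat.pair s k, y, ?_⟩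
    rw [Denumerable.ofNat_encode, Nat.unpair_pair]
    exact hs
  obtain ⟨z, hz⟩ := Part.dom_iff_mem.1 hd
  rwa [Part.mem_unique hy (sound x z hz)]

/-! ### Turing ideals -/

/-- A (countable) Turing ideal together with the choice of an exact pair `left`, `right` for it. -/
structure TuringIdeal where
  carrier : Set (Set ℕ)
  down_closed : ∀ A B : Set ℕ, B ∈ carrier → A ≤ₛ B → A ∈ carrier
  join_closed : ∀ A B : Set ℕ, A ∈ carrier → B ∈ carrier → setJoin A B ∈ carrier
  left : Set ℕ
  right : Set ℕ
  exact_pair : ∀ S : Set ℕ, S ∈ carrier ↔ S ≤ₛ left ∧ S ≤ₛ right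

/-- The collection `⟨A⟩` of all `A`-computable sets. -/
def principal (A : Set ℕ) : Set (Set ℕ) := {S | S ≤ₛ A}

theorem SetReducible.join {A B X : Set ℕ} (hA : A ≤ₛ X) (hB : B ≤ₛ X) : setJoin A B ≤ₛ X := by
  refine RecursiveIn.iff_nat.2 ?_
  have hA' := RecursiveIn.iff_nat.1 hA
  have hB' := RecursiveIn.iff_nat.1 hB
  have half : Nat.RecursiveIn {charFun X} (fun n => ((n / 2 : ℕ) : Part ℕ)) :=
    Nat.Primrec.recursiveIn (Primrec.nat_iff.1 Primrec.nat_div2) |>.of_eq fun n => by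
      simp [Nat.div2_val]
  have idn : Nat.RecursiveIn {charFun X} (fun n => (n : Part ℕ)) :=
    Nat.Primrec.recursiveIn Nat.Primrec.id
  let sel : ℕ → ℕ := fun z =>
    if z.unpair.1 % 2 = 0 then z.unpair.2.unpair.1 else z.unpair.2.unpair.2
  have hsel : Primrec sel := by
    have u1 : Primrec fun z : ℕ => z.unpair.1 := Primrec.fst.comp Primrec.unpair
    have u2 : Primrec fun z : ℕ => z.unpair.2 := Primrec.snd.comp Primrec.unpair
    exact Primrec.ite (Primrec.eq.comp (Primrec.nat_mod.comp u1 (Primrec.const 2))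
      (Primrec.const 0)) (u1.comp u2) (u2.comp u2)
  have hs : Nat.RecursiveIn {charFun X} (fun n => (sel n : Part ℕ)) :=
    Nat.Primrec.recursiveIn (Primrec.nat_iff.1 hsel)
  refine (hs.comp (idn.pair ((hA'.comp half).pair (hB'.comp half)))).of_eq fun n => ?_
  have bindS : ∀ (C : Set ℕ) (m : ℕ), (Part.some m >>= charFun C) = charFun C m :=
    fun C m => Part.bind_some m (charFun C)
  rcases Nat.mod_two_eq_zero_or_one n with h | h <;>
    simp [bindS, Seq.seq] <;>
    simp only [charFun, setJoin, sel] <;>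
    split_ifs <;> simp_all

/-- The principal ideal `⟨A⟩`, with the exact pair `A, A`. -/
def principalIdeal (A : Set ℕ) : TuringIdeal where
  carrier := principal A
  down_closed := fun _ _ hB hA => TuringReducible.trans hA hB
  join_closed := fun _ _ hA hB => SetReducible.join hA hB
  left := A
  right := A
  exact_pair := fun _ => ⟨fun h => ⟨h, h⟩, fun h => h.1⟩

/-! ### Mathias forcing -/

/-- `(D, S)` is a Mathias condition: `D` is finite, `S` is infinite and `max D < min S`. -/
def IsMathiasCondition (c : Finset ℕ × Set ℕ) : Prop :=
  c.2.Infinite ∧ ∀ d ∈ c.1, ∀ s ∈ c.2, d < s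

/-- `c'` extends `c`: `D ⊆ D' ⊆ D ∪ S` and `S' ⊆ S`. -/
def MathiasExtends (c' c : Finset ℕ × Set ℕ) : Prop :=
  c.1 ⊆ c'.1 ∧ (c'.1 : Set ℕ) ⊆ (c.1 : Set ℕ) ∪ c.2 ∧ c'.2 ⊆ c.2

/-- The set `A` satisfies `(D, S)`: `D ⊆ A ⊆ D ∪ S`. -/
def SatisfiesCondition (A : Set ℕ) (c : Finset ℕ × Set ℕ) : Prop :=
  (c.1 : Set ℕ) ⊆ A ∧ A ⊆ (c.1 : Set ℕ) ∪ c.2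

namespace TuringIdeal

/-- The `I`-conditions: the Mathias conditions `(D, S)` with `S ∈ I`. -/
def conditions (I : TuringIdeal) : Set (Finset ℕ × Set ℕ) :=
  {c | IsMathiasCondition c ∧ c.2 ∈ I.carrier}

/-- `i = ⟨d, ⟨e₀, e₁⟩⟩` is an index of `(D, S)`: `d` is the canonical index of the finite set `D`,
and `Φ_{e₀}` with oracle `left` and `Φ_{e₁}` with oracle `right` are both total and equal to
(the characteristic function of) `S`. -/
def IsIndex (I : TuringIdeal) (i : ℕ) (c : Finset ℕ × Set ℕ) : Prop :=
  ∃ e₀ e₁ : ℕ, i = Nat.pair (∑ j ∈ c.1, 2 ^ j) (Nat.pair e₀ e₁) ∧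
    turingFunctional e₀ I.left = charFun c.2 ∧ turingFunctional e₁ I.right = charFun c.2

/-- Every `I`-condition has an index. -/
theorem exists_isIndex (I : TuringIdeal) {c : Finset ℕ × Set ℕ} (hc : c ∈ I.conditions) :
    ∃ i, I.IsIndex i c := by
  obtain ⟨h₀, h₁⟩ := (I.exact_pair c.2).1 hc.2
  obtain ⟨e₀, he₀⟩ := exists_turingFunctional h₀
  obtain ⟨e₁, he₁⟩ := exists_turingFunctional h₁
  exact ⟨_, e₀, e₁, rfl, he₀, he₁⟩

/-- `C` is a `Σ⁰ₙ(I)`-definable collection of `I`-conditions: it consists of the `I`-conditions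
that have an index in some `Σ⁰ₙ(left ⊕ right)` set of numbers. -/
def IsSigmaDefinable (I : TuringIdeal) (n : ℕ) (C : Set (Finset ℕ × Set ℕ)) : Prop :=
  ∃ W : Set ℕ, IsSigma (setJoin I.left I.right) n W ∧
    C = {c | c ∈ I.conditions ∧ ∃ i ∈ W, I.IsIndex i c}

/-- `G` meets `C`: it satisfies some condition in `C`. -/
def Meets (G : Set ℕ) (C : Set (Finset ℕ × Set ℕ)) : Prop :=
  ∃ c ∈ C, SatisfiesCondition G c

/-- `G` avoids `C` (in the forcing with `I`-conditions): it satisfies some `I`-condition that has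
no extension in `C`. -/
def Avoids (I : TuringIdeal) (G : Set ℕ) (C : Set (Finset ℕ × Set ℕ)) : Prop :=
  ∃ c ∈ I.conditions, SatisfiesCondition G c ∧ ∀ c' ∈ C, ¬ MathiasExtends c' c

/-- `G` is `n`-`I`-generic. -/
def IsGeneric (I : TuringIdeal) (n : ℕ) (G : Set ℕ) : Prop :=
  ∀ C, I.IsSigmaDefinable n C → Meets G C ∨ I.Avoids G C

/-- `I` is `n`-generically-coded: every `n`-`I`-generic set computes every member of `I`. -/
def IsGenericallyCoded (I : TuringIdeal) (n : ℕ) : Prop :=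
  ∀ G : Set ℕ, I.IsGeneric n G → ∀ A ∈ I.carrier, A ≤ₛ G

end TuringIdeal

/-! A generic set may be built inside `G`, so it is enough that `G` resists recovery from its own
subsets: for every condition `(K, S)` with `S ⊆ G` computable from `G`, and every `j`, some
extension with reservoir a tail of `S` forces `Φ_j^H ≠ G`. Since only countably many collections of
conditions are definable, whatever the level and the exact pair, a generic sequence below `(∅, G)`
then gives a generic `H` that does not compute `G` (`exists_isGeneric_not_setReducible`).

The set `G` comes from Mathias forcing with conditions `(D, R)`, where `R` is an infinite c.e. set.
As `S = Φ_i^G` for some `i`, the requirements are indexed by triples `(i, j, K)` and can be met in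
three ways (`ForcesRequirement`). Disagreement supplies a finite `F ⊆ S` such that `Φ_j^{K ∪ F}` is
wrong about `G`; disjointness of `Φ_i^G` from `R` is impossible for an infinite `S ⊆ G`; divergence
makes `Φ_j^H` partial for every `H` between `K` and `K` together with a tail of `S`
(`exists_extension_avoiding`).

The heart is density (`exists_refines_forces`). Suppose that no extension forces disjointness. Fix
`a ∈ R` and grow two finite extensions, one containing `a` and one omitting it, so that each round
puts one and the same new number into `{t | Φ_i(t) = 1}` on both sides (`exists_common_extension`).
These numbers form an infinite c.e. set `T`. If `Φ_j^{K ∪ F}(a)` diverges for every finite `F ⊆ T`,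
then `T` is a reservoir that forces divergence. Otherwise some `F` yields a value; both sides
compute `F` but they disagree about `a`, so the value is wrong on one of them.

Extension of conditions is `Π⁰₂` and meeting a requirement is `Σ⁰₃`, so always taking the successor
with the least witness gives a sequence with a `Σ⁰₃` graph (`exists_sigma3_sequence`). Its stage `n
+ 1` decides `G` up to `n`, which makes `G` a `Δ⁰₃` set. -/

/-! ### Arithmetical classes of predicates on primitively coded types -/

section ArithmeticalClasses

variable {α β : Type*} [Primcodable α] [Primcodable β]

/-- Predicates of the form `∃ n, R a n` with `R` primitive recursive. -/
def Sigma1 (P : α → Prop) : Prop :=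
  ∃ R : α → ℕ → Prop, PrimrecRel R ∧ ∀ a, P a ↔ ∃ n, R a n

/-- Predicates of the form `∀ n, Q a n` with `Q` a `Sigma1` predicate. -/
def Pi2 (P : α → Prop) : Prop :=
  ∃ Q : α → ℕ → Prop, Sigma1 (fun p : α × ℕ => Q p.1 p.2) ∧ ∀ a, P a ↔ ∀ n, Q a n

/-- Predicates of the form `∃ n, Q a n` with `Q` a `Pi2` predicate. -/
def Sigma3 (P : α → Prop) : Prop :=
  ∃ Q : α → ℕ → Prop, Pi2 (fun p : α × ℕ => Q p.1 p.2) ∧ ∀ a, P a ↔ ∃ n, Q a n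

theorem PrimrecPred.mem_list {f : α → β} {l : α → List β} (hf : Primrec f) (hl : Primrec l) :
    PrimrecPred fun a => f a ∈ l a :=
  ((PrimrecRel.exists_mem_list (R := fun b c : β => b = c) Primrec.eq).comp hl hf).of_eq
    fun a => by simp

theorem PrimrecPred.exists_mem_decode {R : α → β → Prop} (hR : PrimrecRel R) :
    PrimrecPred fun p : α × ℕ => ∃ b ∈ (Encodable.decode p.2 : Option β), R p.1 b :=
  (hR.swap.exists_mem_list.comp
    (Primrec.optionToList.comp (Primrec.decode.comp Primrec.snd)) Primrec.fst).of_eq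
    fun p => by simp [Function.swap]

namespace Sigma1

variable {P Q : α → Prop}

theorem of_eq (h : Sigma1 P) (H : ∀ a, P a ↔ Q a) : Sigma1 Q := by
  rwa [← funext fun a => propext (H a)]

theorem of_primrec (h : PrimrecPred P) : Sigma1 P :=
  ⟨fun a _ => P a, h.comp Primrec.fst, fun _ => by simp⟩

theorem exists_primrec {R : α → β → Prop} (hR : PrimrecRel R) : Sigma1 fun a => ∃ b, R a b := by
  refine ⟨fun a n => ∃ b ∈ (Encodable.decode n : Option β), R a b,
    PrimrecPred.exists_mem_decode hR, fun a => ⟨?_, ?_⟩⟩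
  · rintro ⟨b, hb⟩
    exact ⟨Encodable.encode b, b, by simp, hb⟩
  · rintro ⟨n, b, -, hb⟩
    exact ⟨b, hb⟩

theorem comp {P : β → Prop} (h : Sigma1 P) {f : α → β} (hf : Primrec f) :
    Sigma1 fun a => P (f a) := by
  obtain ⟨R, hR, H⟩ := h
  exact ⟨fun a n => R (f a) n, hR.comp (hf.comp Primrec.fst) Primrec.snd, fun a => H (f a)⟩

theorem ex {P : α → β → Prop} (h : Sigma1 fun p : α × β => P p.1 p.2) :
    Sigma1 fun a => ∃ b, P a b := by
  obtain ⟨R, hR, H⟩ := h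
  have h2 : PrimrecRel fun (a : α) (q : β × ℕ) => R (a, q.1) q.2 :=
    hR.comp (Primrec.fst.pair (Primrec.fst.comp Primrec.snd)) (Primrec.snd.comp Primrec.snd)
  refine (exists_primrec h2).of_eq fun a => ?_
  simp only [Prod.exists, fun b => H (a, b)]

theorem and (hP : Sigma1 P) (hQ : Sigma1 Q) : Sigma1 fun a => P a ∧ Q a := by
  obtain ⟨R, hR, H⟩ := hP
  obtain ⟨R', hR', H'⟩ := hQ
  have h2 : PrimrecRel fun (a : α) (q : ℕ × ℕ) => R a q.1 ∧ R' a q.2 :=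
    PrimrecPred.and (hR.comp Primrec.fst (Primrec.fst.comp Primrec.snd))
      (hR'.comp Primrec.fst (Primrec.snd.comp Primrec.snd))
  refine (exists_primrec h2).of_eq fun a => ?_
  simp [H, H', Prod.exists]

theorem or (hP : Sigma1 P) (hQ : Sigma1 Q) : Sigma1 fun a => P a ∨ Q a := by
  obtain ⟨R, hR, H⟩ := hP
  obtain ⟨R', hR', H'⟩ := hQ
  exact ⟨fun a n => R a n ∨ R' a n, PrimrecPred.or hR hR', fun a => by
    simp [H, H', exists_or]⟩

/-- A list collects the witnesses for all `x < k a`, so one existential quantifier suffices. No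
condition on its length is needed: the default `0` of `getD` counts as a witness like any other. -/
theorem forall_lt {P : α → ℕ → Prop} (h : Sigma1 fun p : α × ℕ => P p.1 p.2) {k : α → ℕ}
    (hk : Primrec k) : Sigma1 fun a => ∀ x < k a, P a x := by
  obtain ⟨R, hR, H⟩ := h
  have h1 : PrimrecRel fun (x : ℕ) (q : α × List ℕ) => R (q.1, x) (q.2.getD x 0) :=
    hR.comp ((Primrec.fst.comp Primrec.snd).pair Primrec.fst)
      ((Primrec.list_getD 0).comp (Primrec.snd.comp Primrec.snd) Primrec.fst)
  have h2 : PrimrecRel fun (a : α) (l : List ℕ) => ∀ x ∈ List.range (k a), R (a, x) (l.getD x 0) :=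
    (PrimrecRel.forall_mem_list h1).comp
      (Primrec.list_range.comp (hk.comp Primrec.fst)) Primrec.id
  refine (exists_primrec h2).of_eq fun a => ?_
  simp only [List.mem_range]
  constructor
  · rintro ⟨l, hl⟩ x hx
    exact (H (a, x)).2 ⟨_, hl x hx⟩
  · intro hx
    choose! n hn using fun x hxk => (H (a, x)).1 (hx x hxk)
    refine ⟨(List.range (k a)).map n, fun x hxk => ?_⟩
    simpa [List.getD, hxk] using hn x hxk

theorem forall_mem {P : α → ℕ → Prop} (h : Sigma1 fun p : α × ℕ => P p.1 p.2) {l : α → List ℕ}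
    (hl : Primrec l) : Sigma1 fun a => ∀ x ∈ l a, P a x := by
  have h1 : Sigma1 fun p : α × ℕ => P p.1 ((l p.1).getD p.2 0) :=
    h.comp (f := fun p : α × ℕ => (p.1, (l p.1).getD p.2 0))
      (Primrec.fst.pair ((Primrec.list_getD 0).comp (hl.comp Primrec.fst) Primrec.snd))
  refine (forall_lt (P := fun a i => P a ((l a).getD i 0)) h1
    (Primrec.list_length.comp hl)).of_eq fun a => ?_
  constructor
  · intro H x hx
    obtain ⟨i, hi, rfl⟩ := List.getElem_of_mem hx
    simpa [List.getD, hi] using H i hi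
  · intro H i hi
    simpa [List.getD, hi] using H _ (List.getElem_mem hi)

end Sigma1

namespace Pi2

variable {P Q : α → Prop}

theorem of_eq (h : Pi2 P) (H : ∀ a, P a ↔ Q a) : Pi2 Q := by
  rwa [← funext fun a => propext (H a)]

theorem of_sigma1 (h : Sigma1 P) : Pi2 P :=
  ⟨fun a _ => P a, h.comp Primrec.fst, fun _ => by simp⟩

theorem of_not_sigma1 (h : Sigma1 P) : Pi2 fun a => ¬ P a := by
  obtain ⟨R, hR, H⟩ := h
  exact ⟨fun a n => ¬ R a n, Sigma1.of_primrec (PrimrecPred.not hR), fun a => by simp [H]⟩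

theorem comp {P : β → Prop} (h : Pi2 P) {f : α → β} (hf : Primrec f) :
    Pi2 fun a => P (f a) := by
  obtain ⟨R, hR, H⟩ := h
  exact ⟨fun a n => R (f a) n, hR.comp (f := fun p : α × ℕ => (f p.1, p.2))
    ((hf.comp Primrec.fst).pair Primrec.snd), fun a => H (f a)⟩

/-- Numbers that decode to nothing are let through. The decoded element is reached by an existential
quantifier, which keeps the matrix `Sigma1`. -/
theorem all_sigma1 {P : α → β → Prop} (h : Sigma1 fun p : α × β => P p.1 p.2) :
    Pi2 fun a => ∀ b, P a b := by
  refine ⟨fun a n => (Encodable.decode n : Option β) = none ∨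
    ∃ b, b ∈ (Encodable.decode n : Option β) ∧ P a b, Sigma1.or (Sigma1.of_primrec ?_) ?_,
    fun a => ⟨?_, ?_⟩⟩
  · exact Primrec.eq.comp (Primrec.decode.comp Primrec.snd) (Primrec.const none)
  · refine Sigma1.ex (P := fun (p : α × ℕ) (b : β) =>
      b ∈ (Encodable.decode p.2 : Option β) ∧ P p.1 b) (Sigma1.and (Sigma1.of_primrec ?_) ?_)
    · exact Primrec.eq.comp (Primrec.decode.comp (Primrec.snd.comp Primrec.fst))
        (Primrec.option_some.comp Primrec.snd)
    · exact h.comp (f := fun p : (α × ℕ) × β => (p.1.1, p.2))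
        ((Primrec.fst.comp Primrec.fst).pair Primrec.snd)
  · intro H n
    cases hn : (Encodable.decode n : Option β) with
    | none => exact Or.inl rfl
    | some b => exact Or.inr ⟨b, rfl, H b⟩
  · intro H b
    simpa using H (Encodable.encode b)

theorem all {P : α → β → Prop} (h : Pi2 fun p : α × β => P p.1 p.2) :
    Pi2 fun a => ∀ b, P a b := by
  obtain ⟨Q, hQ, H⟩ := h
  refine (all_sigma1 (P := fun (a : α) (q : β × ℕ) => Q (a, q.1) q.2) ?_).of_eq fun a => ?_
  · exact hQ.comp (f := fun p : α × β × ℕ => ((p.1, p.2.1), p.2.2))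
      ((Primrec.fst.pair (Primrec.fst.comp Primrec.snd)).pair (Primrec.snd.comp Primrec.snd))
  · simp only [Prod.forall, fun b => H (a, b)]

theorem and (hP : Pi2 P) (hQ : Pi2 Q) : Pi2 fun a => P a ∧ Q a := by
  obtain ⟨R, hR, H⟩ := hP
  obtain ⟨R', hR', H'⟩ := hQ
  exact ⟨fun a n => R a n ∧ R' a n, hR.and hR', fun a => by simp [H, H', forall_and]⟩

theorem or (hP : Pi2 P) (hQ : Pi2 Q) : Pi2 fun a => P a ∨ Q a := by
  obtain ⟨R, hR, H⟩ := hP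
  obtain ⟨R', hR', H'⟩ := hQ
  refine (all_sigma1 (P := fun (a : α) (q : ℕ × ℕ) => R a q.1 ∨ R' a q.2)
    (Sigma1.or ?_ ?_)).of_eq fun a => ?_
  · exact hR.comp (f := fun p : α × ℕ × ℕ => (p.1, p.2.1))
      (Primrec.fst.pair (Primrec.fst.comp Primrec.snd))
  · exact hR'.comp (f := fun p : α × ℕ × ℕ => (p.1, p.2.2))
      (Primrec.fst.pair (Primrec.snd.comp Primrec.snd))
  · simp only [Prod.forall, H, H', forall_or_left, forall_or_right]

theorem imp (hP : Sigma1 P) (hQ : Pi2 Q) : Pi2 fun a => P a → Q a :=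
  ((of_not_sigma1 hP).or hQ).of_eq fun _ => imp_iff_not_or.symm

end Pi2

namespace Sigma3

variable {P Q : α → Prop}

theorem of_eq (h : Sigma3 P) (H : ∀ a, P a ↔ Q a) : Sigma3 Q := by
  rwa [← funext fun a => propext (H a)]

theorem of_pi2 (h : Pi2 P) : Sigma3 P :=
  ⟨fun a _ => P a, h.comp Primrec.fst, fun _ => by simp⟩

theorem of_sigma1 (h : Sigma1 P) : Sigma3 P := of_pi2 (.of_sigma1 h)

theorem of_primrec (h : PrimrecPred P) : Sigma3 P := of_sigma1 (.of_primrec h)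

theorem of_not_pi2 (h : Pi2 P) : Sigma3 fun a => ¬ P a := by
  obtain ⟨R, hR, H⟩ := h
  exact ⟨fun a n => ¬ R a n, Pi2.of_not_sigma1 hR, fun a => by simp [H]⟩

theorem comp {P : β → Prop} (h : Sigma3 P) {f : α → β} (hf : Primrec f) :
    Sigma3 fun a => P (f a) := by
  obtain ⟨R, hR, H⟩ := h
  exact ⟨fun a n => R (f a) n, hR.comp (f := fun p : α × ℕ => (f p.1, p.2))
    ((hf.comp Primrec.fst).pair Primrec.snd), fun a => H (f a)⟩

/-- Dually to `Pi2.all_sigma1`, numbers that decode to nothing are excluded, and a universal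
quantifier reaches the decoded element, which keeps the matrix `Pi2`. -/
theorem exists_pi2 {P : α → β → Prop} (h : Pi2 fun p : α × β => P p.1 p.2) :
    Sigma3 fun a => ∃ b, P a b := by
  refine ⟨fun a n => (Encodable.decode n : Option β) ≠ none ∧
    ∀ b, b ∈ (Encodable.decode n : Option β) → P a b, Pi2.and (.of_sigma1 (.of_primrec ?_)) ?_,
    fun a => ⟨?_, ?_⟩⟩
  · exact (Primrec.eq.comp (Primrec.decode.comp Primrec.snd) (Primrec.const none)).not
  · refine Pi2.all (P := fun (p : α × ℕ) (b : β) =>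
      b ∈ (Encodable.decode p.2 : Option β) → P p.1 b) (Pi2.imp (Sigma1.of_primrec ?_) ?_)
    · exact Primrec.eq.comp (Primrec.decode.comp (Primrec.snd.comp Primrec.fst))
        (Primrec.option_some.comp Primrec.snd)
    · exact h.comp (f := fun p : (α × ℕ) × β => (p.1.1, p.2))
        ((Primrec.fst.comp Primrec.fst).pair Primrec.snd)
  · rintro ⟨b, hb⟩
    exact ⟨Encodable.encode b, by simp, by simpa using hb⟩
  · rintro ⟨n, hn, H⟩
    obtain ⟨b, hb⟩ := Option.ne_none_iff_exists'.1 hn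
    exact ⟨b, H b hb⟩

theorem ex {P : α → β → Prop} (h : Sigma3 fun p : α × β => P p.1 p.2) :
    Sigma3 fun a => ∃ b, P a b := by
  obtain ⟨Q, hQ, H⟩ := h
  refine (exists_pi2 (P := fun (a : α) (q : β × ℕ) => Q (a, q.1) q.2) ?_).of_eq fun a => ?_
  · exact hQ.comp (f := fun p : α × β × ℕ => ((p.1, p.2.1), p.2.2))
      ((Primrec.fst.pair (Primrec.fst.comp Primrec.snd)).pair (Primrec.snd.comp Primrec.snd))
  · simp only [Prod.exists, fun b => H (a, b)]

theorem and (hP : Sigma3 P) (hQ : Sigma3 Q) : Sigma3 fun a => P a ∧ Q a := by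
  obtain ⟨R, hR, H⟩ := hP
  obtain ⟨R', hR', H'⟩ := hQ
  refine (exists_pi2 (P := fun (a : α) (q : ℕ × ℕ) => R a q.1 ∧ R' a q.2)
    (Pi2.and ?_ ?_)).of_eq fun a => ?_
  · exact hR.comp (f := fun p : α × ℕ × ℕ => (p.1, p.2.1))
      (Primrec.fst.pair (Primrec.fst.comp Primrec.snd))
  · exact hR'.comp (f := fun p : α × ℕ × ℕ => (p.1, p.2.2))
      (Primrec.fst.pair (Primrec.snd.comp Primrec.snd))
  · simp [H, H', Prod.exists]

theorem or (hP : Sigma3 P) (hQ : Sigma3 Q) : Sigma3 fun a => P a ∨ Q a := by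
  obtain ⟨R, hR, H⟩ := hP
  obtain ⟨R', hR', H'⟩ := hQ
  exact ⟨fun a n => R a n ∨ R' a n, hR.or hR', fun a => by simp [H, H', exists_or]⟩

/-- Again a list collects the witnesses. This closure property keeps both minimization and iteration
inside `Sigma3`. -/
theorem forall_lt {P : α → ℕ → Prop} (h : Sigma3 fun p : α × ℕ => P p.1 p.2) {k : α → ℕ}
    (hk : Primrec k) : Sigma3 fun a => ∀ x < k a, P a x := by
  obtain ⟨R, hR, H⟩ := h
  refine (exists_pi2 (P := fun (a : α) (l : List ℕ) => ∀ x, x < k a → R (a, x) (l.getD x 0))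
    (Pi2.all (P := fun (p : α × List ℕ) (x : ℕ) => x < k p.1 → R (p.1, x) (p.2.getD x 0))
      (Pi2.imp (.of_primrec ?_) ?_))).of_eq fun a => ?_
  · exact Primrec.nat_lt.comp Primrec.snd (hk.comp (Primrec.fst.comp Primrec.fst))
  · exact hR.comp (f := fun p : (α × List ℕ) × ℕ => ((p.1.1, p.2), p.1.2.getD p.2 0))
      (((Primrec.fst.comp Primrec.fst).pair Primrec.snd).pair
        ((Primrec.list_getD 0).comp (Primrec.snd.comp Primrec.fst) Primrec.snd))
  constructor
  · rintro ⟨l, hl⟩ x hx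
    exact (H (a, x)).2 ⟨_, hl x hx⟩
  · intro hx
    choose! n hn using fun x hxk => (H (a, x)).1 (hx x hxk)
    refine ⟨(List.range (k a)).map n, fun x hxk => ?_⟩
    simpa [List.getD, hxk] using hn x hxk

end Sigma3

end ArithmeticalClasses

/-! ### Comparison with the hierarchy relative to an oracle -/

theorem SetReducible.of_primrecPred {P X : Set ℕ} (h : PrimrecPred fun n => n ∈ P) : P ≤ₛ X := by
  classical
  refine RecursiveIn.iff_nat.2 ?_
  have h1 : Primrec fun n => if n ∈ P then 1 else 0 :=
    Primrec.ite h (Primrec.const 1) (Primrec.const 0)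
  refine (Nat.Primrec.recursiveIn (Primrec.nat_iff.1 h1)).of_eq fun n => ?_
  simp only [charFun]
  split_ifs <;> simp_all

/-- Each level of `IsSigma` is an existential quantifier over non-membership, so the sets used going
down are `¬ Q`, `R` and `¬ S`. The last one is primitive recursive, hence computable from any
oracle. -/
theorem Sigma3.isSigma {P X : Set ℕ} (h : Sigma3 fun n => n ∈ P) : IsSigma X 3 P := by
  obtain ⟨Q, ⟨R, ⟨S, hS, HS⟩, HR⟩, HQ⟩ := h
  let q : ℕ → ℕ × ℕ := fun m => (m.unpair.1, m.unpair.2)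
  let r : ℕ → (ℕ × ℕ) × ℕ := fun m => (q m.unpair.1, m.unpair.2)
  have hq : Primrec q := (Primrec.fst.comp Primrec.unpair).pair (Primrec.snd.comp Primrec.unpair)
  have hr : Primrec r := (hq.comp (Primrec.fst.comp Primrec.unpair)).pair
    (Primrec.snd.comp Primrec.unpair)
  refine ⟨{m | ¬ Q (q m).1 (q m).2}, ⟨{m | R (r m).1 (r m).2},
    ⟨{m | ¬ S (r m.unpair.1) m.unpair.2}, SetReducible.of_primrecPred ?_, fun m => ?_⟩,
    fun m => ?_⟩, fun m => ?_⟩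
  · exact PrimrecPred.not (hS.comp (hr.comp (Primrec.fst.comp Primrec.unpair))
      (Primrec.snd.comp Primrec.unpair))
  · simp [HS (r m)]
  · simp [r, HR (q m)]
  · simp [q, HQ m]

/-! ### Sequences defined by recursion from arithmetical relations -/

section Sequences

variable {α β : Type*} [Primcodable α]

/-- A finite list that starts at `a₀` and obeys `G` must follow `f`, by uniqueness. Hence the graph
of `f` costs one quantifier over lists and a bounded conjunction of instances of `G`. The invariant
serves only to guarantee that successors exist. -/
theorem exists_sequence_of_functional {α : Type*} {G : ℕ → α → α → Prop}
    (huniq : ∀ n a b b', G n a b → G n a b' → b = b') (Inv : α → Prop) {a₀ : α} (h₀ : Inv a₀)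
    (htot : ∀ n a, Inv a → ∃ b, G n a b) (hinv : ∀ n a b, Inv a → G n a b → Inv b) :
    ∃ f : ℕ → α, f 0 = a₀ ∧ (∀ n, Inv (f n)) ∧ (∀ n, G n (f n) (f (n + 1))) ∧
      ∀ n a, f n = a ↔ ∃ l : List α, l.getD 0 a₀ = a₀ ∧ l.getD n a₀ = a ∧
        ∀ i < n, G i (l.getD i a₀) (l.getD (i + 1) a₀) := by
  choose! g hg using htot
  let f : ℕ → α := fun n => Nat.rec a₀ (fun n a => g n a) n
  have hInv : ∀ n, Inv (f n) := by
    intro n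
    induction n with
    | zero => exact h₀
    | succ n ih => exact hinv n _ _ ih (hg n _ ih)
  have hG : ∀ n, G n (f n) (f (n + 1)) := fun n => hg n _ (hInv n)
  refine ⟨f, rfl, hInv, hG, fun n a => ⟨?_, ?_⟩⟩
  · rintro rfl
    have hl : ∀ i ≤ n, ((List.range (n + 1)).map f).getD i a₀ = f i := by
      intro i hi
      simp [List.getD, Nat.lt_succ_of_le hi]
    refine ⟨(List.range (n + 1)).map f, hl 0 (Nat.zero_le n), hl n le_rfl, fun i hi => ?_⟩
    rw [hl i hi.le, hl (i + 1) hi]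
    exact hG i
  · rintro ⟨l, h0, rfl, hl⟩
    have : ∀ i ≤ n, f i = l.getD i a₀ := by
      intro i
      induction i with
      | zero => exact fun _ => h0.symm
      | succ i ih =>
        intro hi
        have h1 := hl i hi
        rw [← ih (Nat.le_of_succ_le hi)] at h1
        exact huniq i _ _ _ (hG i) h1
    exact this n le_rfl

/-- `m` codes a pair `(b, w)` with `R x b w`. -/
def CodesWitness (R : β → α → ℕ → Prop) (x : β) (m : ℕ) : Prop :=
  ∃ b ∈ (Encodable.decode m.unpair.1 : Option α), R x b m.unpair.2

/-- `b` is the first component of the least pair `(b, w)` with `R x b w`. -/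
def LeastWitness (R : β → α → ℕ → Prop) (x : β) (b : α) : Prop :=
  ∃ m, b ∈ (Encodable.decode m.unpair.1 : Option α) ∧ CodesWitness R x m ∧
    ∀ m' < m, ¬ CodesWitness R x m'

theorem LeastWitness.unique {R : β → α → ℕ → Prop} {x : β} {b b' : α}
    (h : LeastWitness R x b) (h' : LeastWitness R x b') : b = b' := by
  obtain ⟨m, hb, h1, h2⟩ := h
  obtain ⟨m', hb', h1', h2'⟩ := h'
  obtain rfl : m = m' := le_antisymm (not_lt.1 fun hlt => h2 _ hlt h1')
    (not_lt.1 fun hlt => h2' _ hlt h1)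
  exact Option.mem_unique hb hb'

theorem LeastWitness.exists_of {R : β → α → ℕ → Prop} {x : β} (h : ∃ b w, R x b w) :
    ∃ b, LeastWitness R x b := by
  classical
  obtain ⟨b, w, hw⟩ := h
  have hT : ∃ m, CodesWitness R x m := ⟨Nat.pair (Encodable.encode b) w, b, by simp, by simpa⟩
  obtain ⟨b', hb', _⟩ := Nat.find_spec hT
  exact ⟨b', Nat.find hT, hb', Nat.find_spec hT, fun m' hm' => Nat.find_min hT hm'⟩

theorem LeastWitness.spec {R : β → α → ℕ → Prop} {x : β} {b : α} (h : LeastWitness R x b) :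
    ∃ w, R x b w := by
  obtain ⟨m, hb, ⟨b', hb', hR⟩, _⟩ := h
  obtain rfl := Option.mem_unique hb hb'
  exact ⟨_, hR⟩

variable [Primcodable β]

theorem primrecPred_mem_decode : PrimrecPred fun q : α × ℕ =>
    q.1 ∈ (Encodable.decode q.2.unpair.1 : Option α) :=
  Primrec.eq.comp (Primrec.decode.comp (Primrec.fst.comp (Primrec.unpair.comp Primrec.snd)))
    (Primrec.option_some.comp Primrec.fst)

theorem LeastWitness.sigma1 {R : β → α → ℕ → Prop}
    (hR : PrimrecPred fun q : β × α × ℕ => R q.1 q.2.1 q.2.2) :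
    Sigma1 fun p : β × α => LeastWitness R p.1 p.2 := by
  have hT : PrimrecRel fun (m : ℕ) (x : β) => CodesWitness R x m := by
    have h1 : PrimrecRel fun (q : β × ℕ) (b : α) => R q.1 b q.2 :=
      hR.comp (f := fun z : (β × ℕ) × α => (z.1.1, z.2, z.1.2))
        ((Primrec.fst.comp Primrec.fst).pair (Primrec.snd.pair (Primrec.snd.comp Primrec.fst)))
    exact (PrimrecPred.exists_mem_decode h1).comp
      (f := fun p : ℕ × β => ((p.2, p.1.unpair.2), p.1.unpair.1))
      ((Primrec.snd.pair (Primrec.snd.comp (Primrec.unpair.comp Primrec.fst))).pair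
        (Primrec.fst.comp (Primrec.unpair.comp Primrec.fst)))
  refine Sigma1.ex (P := fun (p : β × α) (m : ℕ) =>
    p.2 ∈ (Encodable.decode m.unpair.1 : Option α) ∧ CodesWitness R p.1 m ∧
    ∀ m' < m, ¬ CodesWitness R p.1 m') (Sigma1.of_primrec (PrimrecPred.and ?_ (PrimrecPred.and ?_ ?_)))
  · exact primrecPred_mem_decode.comp ((Primrec.snd.comp Primrec.fst).pair Primrec.snd)
  · exact hT.comp Primrec.snd (Primrec.fst.comp Primrec.fst)
  · refine ((PrimrecRel.forall_mem_list hT.not).comp (Primrec.list_range.comp Primrec.snd)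
      (Primrec.fst.comp Primrec.fst)).of_eq fun a => ?_
    simp

/-- For a `Pi2` matrix, the failure of all smaller codes is a bounded conjunction of negated `Pi2`
statements, hence still `Sigma3`. Uniformizing a `Sigma3` relation therefore does not raise its
complexity. -/
theorem LeastWitness.sigma3 {R : β → α → ℕ → Prop}
    (hR : Pi2 fun q : β × α × ℕ => R q.1 q.2.1 q.2.2) :
    Sigma3 fun p : β × α => LeastWitness R p.1 p.2 := by
  have hT : Pi2 fun p : β × ℕ => CodesWitness R p.1 p.2 := by
    -- A code decodes to at most one `b`, so the existential quantifier in `CodesWitness` may be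
    -- traded for a universal one.
    refine (Pi2.and (.of_sigma1 (.of_primrec (.not (Primrec.eq.comp (Primrec.decode.comp
      (Primrec.fst.comp (Primrec.unpair.comp Primrec.snd))) (Primrec.const (none : Option α))))))
      (Pi2.all (P := fun (p : β × ℕ) (b : α) =>
        b ∈ (Encodable.decode p.2.unpair.1 : Option α) → R p.1 b p.2.unpair.2)
        (Pi2.imp (.of_primrec ?_) ?_))).of_eq fun p => ?_
    · exact primrecPred_mem_decode.comp (f := fun z : (β × ℕ) × α => (z.2, z.1.2))
        (Primrec.snd.pair (Primrec.snd.comp Primrec.fst))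
    · exact hR.comp (f := fun z : (β × ℕ) × α => (z.1.1, z.2, z.1.2.unpair.2))
        ((Primrec.fst.comp Primrec.fst).pair (Primrec.snd.pair
          (Primrec.snd.comp (Primrec.unpair.comp (Primrec.snd.comp Primrec.fst)))))
    · constructor
      · rintro ⟨hn, H⟩
        obtain ⟨b, hb⟩ := Option.ne_none_iff_exists'.1 hn
        exact ⟨b, hb, H b hb⟩
      · rintro ⟨b, hb, H⟩
        refine ⟨by rw [Option.mem_def.1 hb]; simp, fun b' hb' => ?_⟩
        rwa [Option.mem_unique hb' hb]
  refine Sigma3.ex (P := fun (p : β × α) (m : ℕ) =>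
    p.2 ∈ (Encodable.decode m.unpair.1 : Option α) ∧ CodesWitness R p.1 m ∧
    ∀ m' < m, ¬ CodesWitness R p.1 m')
    (Sigma3.and (.of_primrec ?_) (Sigma3.and (.of_pi2 ?_) ?_))
  · exact primrecPred_mem_decode.comp ((Primrec.snd.comp Primrec.fst).pair Primrec.snd)
  · exact hT.comp (f := fun z : (β × α) × ℕ => (z.1.1, z.2))
      ((Primrec.fst.comp Primrec.fst).pair Primrec.snd)
  · refine Sigma3.forall_lt (P := fun (z : (β × α) × ℕ) m' => ¬ CodesWitness R z.1.1 m')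
      (Sigma3.of_not_pi2 ?_) Primrec.snd
    exact hT.comp (f := fun z : ((β × α) × ℕ) × ℕ => (z.1.1.1, z.2))
      ((Primrec.fst.comp (Primrec.fst.comp Primrec.fst)).pair Primrec.snd)

/-- Minimizing over codes of a successor paired with a witness turns `P` into a function with a
`Sigma1` graph; plain minimization over successors would not stay in this class. -/
theorem exists_sigma1_sequence {P : α → α → Prop} (hP : Sigma1 fun q : α × α => P q.1 q.2)
    (Inv : α → Prop) {a₀ : α} (h₀ : Inv a₀) (htot : ∀ a, Inv a → ∃ b, P a b)
    (hinv : ∀ a b, Inv a → P a b → Inv b) :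
    ∃ f : ℕ → α, f 0 = a₀ ∧ (∀ n, Inv (f n)) ∧ (∀ n, P (f n) (f (n + 1))) ∧
      Sigma1 fun q : ℕ × α => f q.1 = q.2 := by
  obtain ⟨R, hR, H⟩ := hP
  let S : α → α → ℕ → Prop := fun a b w => R (a, b) w
  have hS : Sigma1 fun p : α × α => LeastWitness S p.1 p.2 :=
    LeastWitness.sigma1 (hR.comp (f := fun q : α × α × ℕ => (q.1, q.2.1))
      (Primrec.fst.pair (Primrec.fst.comp Primrec.snd)) (Primrec.snd.comp Primrec.snd))
  have hSP : ∀ a b, LeastWitness S a b → P a b := fun a b h => (H (a, b)).2 h.spec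
  obtain ⟨f, h0, h1, h2, h3⟩ := exists_sequence_of_functional
    (G := fun _ a b => LeastWitness S a b) (fun _ _ _ _ h h' => h.unique h') Inv h₀
    (fun _ a ha => LeastWitness.exists_of ((htot a ha).imp fun b hb => (H (a, b)).1 hb))
    (fun _ a b ha hb => hinv a b ha (hSP a b hb))
  refine ⟨f, h0, h1, fun n => hSP _ _ (h2 n), Sigma1.of_eq ?_ fun q => (h3 q.1 q.2).symm⟩
  have hd {γ : Type _} [Primcodable γ] {l : γ → List α} {k : γ → ℕ} (hl : Primrec l)
      (hk : Primrec k) : Primrec fun z => (l z).getD (k z) a₀ := (Primrec.list_getD a₀).comp hl hk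
  refine Sigma1.ex (P := fun (q : ℕ × α) (l : List α) => l.getD 0 a₀ = a₀ ∧ l.getD q.1 a₀ = q.2 ∧
    ∀ i < q.1, LeastWitness S (l.getD i a₀) (l.getD (i + 1) a₀))
    (Sigma1.and (.of_primrec ?_) (Sigma1.and (.of_primrec ?_) ?_))
  · exact Primrec.eq.comp (hd Primrec.snd (Primrec.const 0)) (Primrec.const a₀)
  · exact Primrec.eq.comp (hd Primrec.snd (Primrec.fst.comp Primrec.fst))
      (Primrec.snd.comp Primrec.fst)
  · refine Sigma1.forall_lt (P := fun (z : (ℕ × α) × List α) i =>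
      LeastWitness S (z.2.getD i a₀) (z.2.getD (i + 1) a₀)) ?_ (Primrec.fst.comp Primrec.fst)
    exact hS.comp (f := fun z : ((ℕ × α) × List α) × ℕ =>
      (z.1.2.getD z.2 a₀, z.1.2.getD (z.2 + 1) a₀))
      ((hd (Primrec.snd.comp Primrec.fst) Primrec.snd).pair
        (hd (Primrec.snd.comp Primrec.fst) (Primrec.succ.comp Primrec.snd)))

theorem exists_sigma3_sequence {P : ℕ → α → α → Prop}
    (hP : Sigma3 fun q : (ℕ × α) × α => P q.1.1 q.1.2 q.2)
    (Inv : α → Prop) {a₀ : α} (h₀ : Inv a₀) (htot : ∀ n a, Inv a → ∃ b, P n a b)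
    (hinv : ∀ n a b, Inv a → P n a b → Inv b) :
    ∃ f : ℕ → α, f 0 = a₀ ∧ (∀ n, Inv (f n)) ∧ (∀ n, P n (f n) (f (n + 1))) ∧
      Sigma3 fun q : ℕ × α => f q.1 = q.2 := by
  obtain ⟨R, hR, H⟩ := hP
  let S : ℕ × α → α → ℕ → Prop := fun a b w => R (a, b) w
  have hS : Sigma3 fun p : (ℕ × α) × α => LeastWitness S p.1 p.2 :=
    LeastWitness.sigma3 (hR.comp (f := fun q : (ℕ × α) × α × ℕ => ((q.1, q.2.1), q.2.2))
      ((Primrec.fst.pair (Primrec.fst.comp Primrec.snd)).pair (Primrec.snd.comp Primrec.snd)))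
  have hSP : ∀ n a b, LeastWitness S (n, a) b → P n a b :=
    fun n a b h => (H ((n, a), b)).2 h.spec
  obtain ⟨f, h0, h1, h2, h3⟩ := exists_sequence_of_functional
    (G := fun n a b => LeastWitness S (n, a) b) (fun _ _ _ _ h h' => h.unique h') Inv h₀
    (fun n a ha => LeastWitness.exists_of ((htot n a ha).imp fun b hb => (H ((n, a), b)).1 hb))
    (fun n a b ha hb => hinv n a b ha (hSP n a b hb))
  refine ⟨f, h0, h1, fun n => hSP _ _ _ (h2 n), Sigma3.of_eq ?_ fun q => (h3 q.1 q.2).symm⟩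
  have hd {γ : Type _} [Primcodable γ] {l : γ → List α} {k : γ → ℕ} (hl : Primrec l)
      (hk : Primrec k) : Primrec fun z => (l z).getD (k z) a₀ := (Primrec.list_getD a₀).comp hl hk
  refine Sigma3.ex (P := fun (q : ℕ × α) (l : List α) => l.getD 0 a₀ = a₀ ∧ l.getD q.1 a₀ = q.2 ∧
    ∀ i < q.1, LeastWitness S (i, l.getD i a₀) (l.getD (i + 1) a₀))
    (Sigma3.and (.of_primrec ?_) (Sigma3.and (.of_primrec ?_) ?_))
  · exact Primrec.eq.comp (hd Primrec.snd (Primrec.const 0)) (Primrec.const a₀)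
  · exact Primrec.eq.comp (hd Primrec.snd (Primrec.fst.comp Primrec.fst))
      (Primrec.snd.comp Primrec.fst)
  · refine Sigma3.forall_lt (P := fun (z : (ℕ × α) × List α) i =>
      LeastWitness S (i, z.2.getD i a₀) (z.2.getD (i + 1) a₀)) ?_ (Primrec.fst.comp Primrec.fst)
    exact hS.comp (f := fun z : ((ℕ × α) × List α) × ℕ =>
      ((z.2, z.1.2.getD z.2 a₀), z.1.2.getD (z.2 + 1) a₀))
      ((Primrec.snd.pair (hd (Primrec.snd.comp Primrec.fst) Primrec.snd)).pair
        (hd (Primrec.snd.comp Primrec.fst) (Primrec.succ.comp Primrec.snd)))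

end Sequences

/-! ### The use of a Turing functional -/

/-- The result of the `T`-th stage of the search that computes `turingFunctional e A x`. -/
noncomputable def turingStage (e : ℕ) (A : Set ℕ) (x T : ℕ) : Option ℕ :=
  Nat.Partrec.Code.evaln T.unpair.1 (Denumerable.ofNat Nat.Partrec.Code e)
    (Nat.pair (Encodable.encode (initSeg A T.unpair.2)) x)

/-- The computation of `turingFunctional e A x` halts with output `y` before stage `u`; in
particular it uses only the part of the oracle `A` below `u`. -/
def HaltsBefore (e : ℕ) (A : Set ℕ) (x u y : ℕ) : Prop :=
  ∃ T < u, turingStage e A x T = some y ∧ ∀ T' < T, turingStage e A x T' = none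

theorem mem_turingFunctional {e : ℕ} {A : Set ℕ} {x y : ℕ} :
    y ∈ turingFunctional e A x ↔ ∃ u, HaltsBefore e A x u y := by
  change y ∈ Nat.rfindOpt (turingStage e A x) ↔ _
  rw [Nat.rfindOpt, Part.mem_bind_iff]
  constructor
  · rintro ⟨T, hT, hy⟩
    have h := Nat.mem_rfind.1 hT
    refine ⟨T + 1, T, Nat.lt_succ_self T, by simpa using hy, fun T' hT' => ?_⟩
    have h' := h.2 hT'
    simpa using h'
  · rintro ⟨u, T, -, hy, hT⟩
    refine ⟨T, Nat.mem_rfind.2 ⟨by simp [hy], fun {T'} hT' => by simp [hT T' hT']⟩, by simp [hy]⟩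

theorem initSeg_congr {A B : Set ℕ} {k : ℕ} (h : ∀ z < k, z ∈ A ↔ z ∈ B) :
    initSeg A k = initSeg B k := by
  refine List.map_congr_left fun z hz => ?_
  simp [h z (List.mem_range.1 hz)]

/-- Stage `T` reads the oracle only below `T.unpair.2 ≤ T`, so a bound on the stage is a bound on
the use. The earlier stages transfer as well, which matters because the value is that of the first
halting stage. -/
theorem HaltsBefore.congr {e : ℕ} {A B : Set ℕ} {x u v y : ℕ} (h : HaltsBefore e A x u y)
    (huv : u ≤ v) (hAB : ∀ z < u, z ∈ A ↔ z ∈ B) : HaltsBefore e B x v y := by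
  obtain ⟨T, hT, hy, hT'⟩ := h
  have key : ∀ S ≤ T, turingStage e B x S = turingStage e A x S := by
    intro S hS
    rw [turingStage, turingStage, initSeg_congr fun z hz => hAB z ?_]
    exact hz.trans_le ((Nat.unpair_right_le S).trans (hS.trans hT.le))
  exact ⟨T, hT.trans_le huv, (key T le_rfl).trans hy, fun S hS => (key S hS.le).trans (hT' S hS)⟩

theorem HaltsBefore.mem {e : ℕ} {A B : Set ℕ} {x u y : ℕ} (h : HaltsBefore e A x u y)
    (hAB : ∀ z < u, z ∈ A ↔ z ∈ B) : y ∈ turingFunctional e B x :=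
  mem_turingFunctional.2 ⟨u, h.congr le_rfl hAB⟩

/-- The set of members of a list. -/
def listSet (l : List ℕ) : Set ℕ := {z | z ∈ l}

@[simp] theorem mem_listSet {l : List ℕ} {z : ℕ} : z ∈ listSet l ↔ z ∈ l := Iff.rfl

theorem primrec_turingStage :
    Primrec fun q : (ℕ × List ℕ × ℕ) × ℕ => turingStage q.1.1 (listSet q.1.2.1) q.1.2.2 q.2 := by
  have hseg : Primrec fun q : List ℕ × ℕ => initSeg (listSet q.1) q.2 := by
    refine Primrec.list_map (Primrec.list_range.comp Primrec.snd)
      (@PrimrecPred.decide _ _ (fun z : (List ℕ × ℕ) × ℕ => z.2 ∈ listSet z.1.1)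
        (fun _ => Classical.propDecidable _)
        (PrimrecPred.mem_list Primrec.snd (Primrec.fst.comp Primrec.fst)))
  have h2 : Primrec fun q : (ℕ × List ℕ × ℕ) × ℕ => q.2.unpair := Primrec.unpair.comp Primrec.snd
  exact Nat.Partrec.Code.primrec_evaln.comp
    (((Primrec.fst.comp h2).pair ((Primrec.ofNat _).comp (Primrec.fst.comp Primrec.fst))).pair
      (Primrec₂.natPair.comp
        (Primrec.encode.comp (hseg.comp ((Primrec.fst.comp (Primrec.snd.comp Primrec.fst)).pair
          (Primrec.snd.comp h2))))
        (Primrec.snd.comp (Primrec.snd.comp Primrec.fst))))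

theorem primrecPred_haltsBefore : PrimrecPred fun q : (ℕ × List ℕ × ℕ) × ℕ × ℕ =>
    HaltsBefore q.1.1 (listSet q.1.2.1) q.1.2.2 q.2.1 q.2.2 := by
  have h1 : PrimrecRel fun (T : ℕ) (q : ℕ × List ℕ × ℕ) =>
      turingStage q.1 (listSet q.2.1) q.2.2 T = none :=
    Primrec.eq.comp (primrec_turingStage.comp (Primrec.snd.pair Primrec.fst)) (Primrec.const none)
  have h2 : PrimrecRel fun (T : ℕ) (q : (ℕ × List ℕ × ℕ) × ℕ) =>
      turingStage q.1.1 (listSet q.1.2.1) q.1.2.2 T = some q.2 ∧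
        ∀ T' ∈ List.range T, turingStage q.1.1 (listSet q.1.2.1) q.1.2.2 T' = none :=
    PrimrecPred.and
      (Primrec.eq.comp (primrec_turingStage.comp ((Primrec.fst.comp Primrec.snd).pair Primrec.fst))
        (Primrec.option_some.comp (Primrec.snd.comp Primrec.snd)))
      (h1.forall_mem_list.comp (Primrec.list_range.comp Primrec.fst)
        (Primrec.fst.comp Primrec.snd))
  refine (h2.exists_mem_list.comp (Primrec.list_range.comp (Primrec.fst.comp Primrec.snd))
    (Primrec.fst.pair (Primrec.snd.comp Primrec.snd))).of_eq fun q => ?_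
  simp [HaltsBefore]

theorem sigma1_mem_turingFunctional : Sigma1 fun q : (ℕ × List ℕ × ℕ) × ℕ =>
    q.2 ∈ turingFunctional q.1.1 (listSet q.1.2.1) q.1.2.2 := by
  have h : PrimrecRel fun (q : (ℕ × List ℕ × ℕ) × ℕ) (u : ℕ) =>
      HaltsBefore q.1.1 (listSet q.1.2.1) q.1.2.2 u q.2 :=
    primrecPred_haltsBefore.comp (f := fun z : ((ℕ × List ℕ × ℕ) × ℕ) × ℕ => (z.1.1, z.2, z.1.2))
      ((Primrec.fst.comp Primrec.fst).pair (Primrec.snd.pair (Primrec.snd.comp Primrec.fst)))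
  exact (Sigma1.exists_primrec h).of_eq fun q => mem_turingFunctional.symm

/-! ### Computably enumerable sets -/

/-- The domain of the partial recursive function with code `c`. -/
def codeDom (c : Nat.Partrec.Code) : Set ℕ := {x | (c.eval x).Dom}

theorem sigma1_mem_codeDom : Sigma1 fun p : Nat.Partrec.Code × ℕ => p.2 ∈ codeDom p.1 := by
  have h : PrimrecRel fun (p : Nat.Partrec.Code × ℕ) (q : ℕ × ℕ) =>
      Nat.Partrec.Code.evaln q.1 p.1 p.2 = some q.2 :=
    Primrec.eq.comp (Nat.Partrec.Code.primrec_evaln.comp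
      (((Primrec.fst.comp Primrec.snd).pair (Primrec.fst.comp Primrec.fst)).pair
        (Primrec.snd.comp Primrec.fst)))
      (Primrec.option_some.comp (Primrec.snd.comp Primrec.snd))
  refine (Sigma1.exists_primrec h).of_eq fun p => ?_
  simp only [codeDom, Set.mem_ofPred_eq, Part.dom_iff_mem, Nat.Partrec.Code.evaln_complete,
    Option.mem_def, Prod.exists]
  exact exists_comm

/-- Codes name the c.e. reservoirs, so that conditions become elements of a `Primcodable` type on
which the arithmetical recursion can run. -/
theorem exists_codeDom_eq {R : Set ℕ} (h : Sigma1 fun x => x ∈ R) : ∃ c, codeDom c = R := by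
  classical
  obtain ⟨S, hS, H⟩ := h
  have h1 : Partrec fun x => Nat.rfind fun n => Part.some (decide (S x n)) :=
    Partrec.rfind (p := fun x n => Part.some (decide (S x n))) hS.decide.to_comp.partrec₂
  obtain ⟨c, hc⟩ := Nat.Partrec.Code.exists_code.1 (Partrec.nat_iff.1 h1)
  refine ⟨c, Set.ext fun x => ?_⟩
  have h2 : x ∈ codeDom c ↔ (Nat.rfind fun n => Part.some (decide (S x n))).Dom := by
    rw [codeDom, Set.mem_ofPred_eq, hc]
  refine h2.trans (Nat.rfind_dom.trans (Iff.trans ?_ (H x).symm))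
  exact exists_congr fun n => ⟨fun h => by simpa using h.1, fun h => ⟨by simpa using h, fun _ => trivial⟩⟩

/-! ### Mathias forcing with computably enumerable reservoirs -/

/-- The condition `(D', R')` extends `(D, R)`, and it is a Mathias condition. -/
structure Refines (D : List ℕ) (R : Set ℕ) (D' : List ℕ) (R' : Set ℕ) : Prop where
  subset : ∀ z ∈ D, z ∈ D'
  mem_or : ∀ z ∈ D', z ∈ D ∨ z ∈ R
  reservoir : ∀ z ∈ R', z ∈ R
  unbounded : ∀ n, ∃ z, n ≤ z ∧ z ∈ R'
  lt : ∀ z ∈ R', ∀ d ∈ D', d < z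

theorem Refines.trans {D D' D'' : List ℕ} {R R' R'' : Set ℕ} (h : Refines D R D' R')
    (h' : Refines D' R' D'' R'') : Refines D R D'' R'' where
  subset z hz := h'.subset z (h.subset z hz)
  mem_or z hz := (h'.mem_or z hz).elim (h.mem_or z) fun hz => Or.inr (h.reservoir z hz)
  reservoir z hz := h.reservoir z (h'.reservoir z hz)
  unbounded := h'.unbounded
  lt := h'.lt

/-- For every set `G` that satisfies `(D, R)`, there is a finite set `F ⊆ {t | Φ_i^G(t) = 1}` such
that `Φ_j^{K ∪ F}` differs from the characteristic function of `G`. -/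
def ForcesDisagreement (i j : ℕ) (K D : List ℕ) (R : Set ℕ) : Prop :=
  ∃ (F : List ℕ) (x u y : ℕ), (∀ t ∈ F, HaltsBefore i (listSet D) t u 1) ∧ (∀ z ∈ R, u ≤ z) ∧
    y ∈ turingFunctional j (listSet (K ++ F)) x ∧ ((x ∈ D ∧ y ≠ 1) ∨ (x ∉ D ∧ x < u ∧ y ≠ 0))

/-- For every set `G` that satisfies `(D, R)`, the set `{t | Φ_i^G(t) = 1}` is disjoint
from `R`. -/
def ForcesDisjoint (i : ℕ) (D : List ℕ) (R : Set ℕ) : Prop :=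
  ∀ (E : List ℕ) (t : ℕ), (∀ z ∈ E, z ∈ R) → t ∈ R → 1 ∉ turingFunctional i (listSet (D ++ E)) t

/-- For some `x`, the functional `Φ_j` diverges at `x` for all oracles `K ∪ F` with `F ⊆ R`
finite. -/
def ForcesDivergence (j : ℕ) (K : List ℕ) (R : Set ℕ) : Prop :=
  ∃ x, ∀ (F : List ℕ) (y : ℕ), (∀ z ∈ F, z ∈ R) → y ∉ turingFunctional j (listSet (K ++ F)) x

/-- The part of `R` from `k` on. -/
def tailFrom (R : Set ℕ) (k : ℕ) : Set ℕ := {z | z ∈ R ∧ k ≤ z}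

@[simp] theorem mem_tailFrom {R : Set ℕ} {k z : ℕ} : z ∈ tailFrom R k ↔ z ∈ R ∧ k ≤ z := Iff.rfl

theorem sigma1_tailFrom {R : Set ℕ} (h : Sigma1 fun z => z ∈ R) (k : ℕ) :
    Sigma1 fun z => z ∈ tailFrom R k :=
  h.and (.of_primrec (Primrec.nat_le.comp (Primrec.const k) Primrec.id))

theorem tailFrom_unbounded {R : Set ℕ} (h : ∀ n, ∃ z, n ≤ z ∧ z ∈ R) (k n : ℕ) :
    ∃ z, n ≤ z ∧ z ∈ tailFrom R k := by
  obtain ⟨z, hz, hzR⟩ := h (max n k)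
  exact ⟨z, (le_max_left _ _).trans hz, hzR, (le_max_right _ _).trans hz⟩

theorem List.exists_forall_mem_lt (l : List ℕ) : ∃ b, ∀ z ∈ l, z < b :=
  ⟨l.sum + 1, fun _ hz => Nat.lt_succ_of_le (List.le_sum_of_mem hz)⟩

/-- The finite set `E'` end-extends `E` by elements of `R` between `u` and `v`, and
`Φ_i^{K ∪ E'}(t) = 1`. -/
def ExtendsWithOne (i : ℕ) (K : List ℕ) (R : Set ℕ) (E : List ℕ) (u : ℕ) (E' : List ℕ)
    (t v : ℕ) : Prop :=
  (∀ z ∈ E, z ∈ E') ∧ (∀ z ∈ E', (z ∈ E ∨ (z ∈ R ∧ u ≤ z)) ∧ z < v) ∧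
    HaltsBefore i (listSet (K ++ E')) t v 1

theorem sigma1_extendsWithOne (i : ℕ) (K : List ℕ) {R : Set ℕ} (h : Sigma1 fun z => z ∈ R) :
    Sigma1 fun q : (List ℕ × ℕ) × List ℕ × ℕ × ℕ =>
      ExtendsWithOne i K R q.1.1 q.1.2 q.2.1 q.2.2.1 q.2.2.2 := by
  have hE : Primrec fun q : (List ℕ × ℕ) × List ℕ × ℕ × ℕ => q.1.1 := Primrec.fst.comp Primrec.fst
  have hu : Primrec fun q : (List ℕ × ℕ) × List ℕ × ℕ × ℕ => q.1.2 := Primrec.snd.comp Primrec.fst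
  have hE' : Primrec fun q : (List ℕ × ℕ) × List ℕ × ℕ × ℕ => q.2.1 :=
    Primrec.fst.comp Primrec.snd
  have ht : Primrec fun q : (List ℕ × ℕ) × List ℕ × ℕ × ℕ => q.2.2.1 :=
    Primrec.fst.comp (Primrec.snd.comp Primrec.snd)
  have hv : Primrec fun q : (List ℕ × ℕ) × List ℕ × ℕ × ℕ => q.2.2.2 :=
    Primrec.snd.comp (Primrec.snd.comp Primrec.snd)
  refine Sigma1.and (Sigma1.forall_mem (P := fun q z => z ∈ q.2.1) (.of_primrec ?_) hE)
    (Sigma1.and (Sigma1.forall_mem (P := fun q z => (z ∈ q.1.1 ∨ (z ∈ R ∧ q.1.2 ≤ z)) ∧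
      z < q.2.2.2) (Sigma1.and (Sigma1.or (.of_primrec ?_) (Sigma1.and (h.comp Primrec.snd)
        (.of_primrec ?_))) (.of_primrec ?_)) hE') (.of_primrec ?_))
  · exact PrimrecPred.mem_list Primrec.snd (hE'.comp Primrec.fst)
  · exact PrimrecPred.mem_list Primrec.snd (hE.comp Primrec.fst)
  · exact Primrec.nat_le.comp (hu.comp Primrec.fst) Primrec.snd
  · exact Primrec.nat_lt.comp Primrec.snd (hv.comp Primrec.fst)
  · exact primrecPred_haltsBefore.comp (f := fun q : (List ℕ × ℕ) × List ℕ × ℕ × ℕ =>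
      ((i, K ++ q.2.1, q.2.2.1), q.2.2.2, 1))
      (((Primrec.const i).pair ((Primrec.list_append.comp (Primrec.const K) hE').pair ht)).pair
        (hv.pair (Primrec.const 1)))

/-! ### Density of the conditions that meet a requirement -/

section Density

variable {D : List ℕ} {R : Set ℕ} {i : ℕ}

theorem extendsWithOne_of_mem {K E F : List ℕ} {k u t v : ℕ} (huk : u ≤ k)
    (hE : ∀ z ∈ E, z < u) (huv : u ≤ v) (hF : ∀ z ∈ F, z ∈ tailFrom R k) (hFv : ∀ z ∈ F, z < v)
    (h : HaltsBefore i (listSet (K ++ E ++ F)) t v 1) :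
    ExtendsWithOne i K R E u (E ++ F) t v := by
  refine ⟨fun z hz => List.mem_append_left _ hz, fun z hz => ?_, by rwa [← List.append_assoc]⟩
  rcases List.mem_append.1 hz with hz | hz
  · exact ⟨Or.inl hz, (hE z hz).trans_le huv⟩
  · exact ⟨Or.inr ⟨(hF z hz).1, huk.trans (hF z hz).2⟩, hFv z hz⟩

/-- If no refinement of `(D, R)` forces `{t | Φ_i^G(t) = 1}` to be disjoint from the reservoir, then
a computation with `a ∈ G` and one with `a ∉ G` can be extended so that they put a common new
element into this set. -/
theorem exists_common_extension (hS : Sigma1 fun z => z ∈ R) (hR : Refines D R D R)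
    (hno : ∀ D' R', (Sigma1 fun z => z ∈ R') → Refines D R D' R' → ¬ ForcesDisjoint i D' R')
    {a : ℕ} (ha : a ∈ R) {E₀ E₁ : List ℕ} {u : ℕ} (h₀ : ∀ z ∈ E₀, z ∈ R ∧ z < u)
    (h₁ : ∀ z ∈ E₁, z ∈ R ∧ z < u) (hau : a < u) :
    ∃ t v E₀' E₁', t ∈ R ∧ u ≤ t ∧ t < v ∧ ExtendsWithOne i (a :: D) R E₀ u E₀' t v ∧
      ExtendsWithOne i D R E₁ u E₁' t v := by
  -- `M` consists of the numbers that the side with `a` can still put into its set. Being c.e., it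
  -- can serve as reservoir for the side without `a`, and whatever element of `M` that side produces
  -- is common to both.
  let M : Set ℕ := {t | t ∈ tailFrom R u ∧ ∃ E : List ℕ, (∀ z ∈ E, z ∈ tailFrom R u) ∧
    1 ∈ turingFunctional i (listSet (a :: D ++ E₀ ++ E)) t}
  have hM : Sigma1 fun z => z ∈ M := by
    refine (sigma1_tailFrom hS u).and (Sigma1.ex (P := fun (t : ℕ) (E : List ℕ) =>
      (∀ z ∈ E, z ∈ tailFrom R u) ∧ 1 ∈ turingFunctional i (listSet (a :: D ++ E₀ ++ E)) t)
      (Sigma1.and (Sigma1.forall_mem (P := fun _ z => z ∈ tailFrom R u)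
        ((sigma1_tailFrom hS u).comp Primrec.snd) Primrec.snd) ?_))
    exact sigma1_mem_turingFunctional.comp (f := fun p : ℕ × List ℕ =>
      ((i, a :: D ++ E₀ ++ p.2, p.1), 1))
      (((Primrec.const i).pair ((Primrec.list_append.comp (Primrec.const _) Primrec.snd).pair
        Primrec.fst)).pair (Primrec.const 1))
  have hMR : ∀ z ∈ M, z ∈ R := fun z hz => hz.1.1
  have hMu : ∀ z ∈ M, u ≤ z := fun z hz => hz.1.2
  have hMinf : ∀ n, ∃ z, n ≤ z ∧ z ∈ M := by
    intro n
    -- Failure of disjointness for this condition gives an element of `M` that is at least `n`.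
    have href : Refines D R (a :: D ++ E₀) (tailFrom R (max u n)) := by
      refine ⟨fun z hz => by simp [hz], fun z hz => ?_, fun z hz => hz.1,
        tailFrom_unbounded hR.unbounded _, fun z hz d hd => ?_⟩
      · simp only [List.cons_append, List.mem_cons, List.mem_append] at hz
        rcases hz with rfl | hz | hz
        exacts [Or.inr ha, Or.inl hz, Or.inr (h₀ z hz).1]
      · have huz : u ≤ z := (le_max_left _ _).trans hz.2
        simp only [List.cons_append, List.mem_cons, List.mem_append] at hd
        rcases hd with rfl | hd | hd
        exacts [hau.trans_le huz, hR.lt z hz.1 d hd, (h₀ d hd).2.trans_le huz]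
    have h := hno _ _ (sigma1_tailFrom hS _) href
    simp only [ForcesDisjoint, not_forall, not_not] at h
    obtain ⟨E, t, hE, ht, h1⟩ := h
    exact ⟨t, (le_max_right _ _).trans ht.2, ⟨ht.1, (le_max_left _ _).trans ht.2⟩, E,
      fun z hz => ⟨(hE z hz).1, (le_max_left _ _).trans (hE z hz).2⟩, h1⟩
  have href : Refines D R (D ++ E₁) M := by
    refine ⟨fun z hz => by simp [hz], fun z hz => ?_, hMR, hMinf, fun z hz d hd => ?_⟩
    · rcases List.mem_append.1 hz with hz | hz
      exacts [Or.inl hz, Or.inr (h₁ z hz).1]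
    · rcases List.mem_append.1 hd with hd | hd
      exacts [hR.lt z (hMR z hz) d hd, (h₁ d hd).2.trans_le (hMu z hz)]
  have h := hno _ _ hM href
  simp only [ForcesDisjoint, not_forall, not_not] at h
  obtain ⟨F₁, t, hF₁, ⟨ht, F₀, hF₀, hone₀⟩, hone₁⟩ := h
  obtain ⟨v₀, hv₀⟩ := mem_turingFunctional.1 hone₀
  obtain ⟨v₁, hv₁⟩ := mem_turingFunctional.1 hone₁
  obtain ⟨b₀, hb₀⟩ := F₀.exists_forall_mem_lt
  obtain ⟨b₁, hb₁⟩ := F₁.exists_forall_mem_lt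
  -- The sum exceeds `t` and all elements of `F₀` and `F₁`, and is at least `u` and both uses.
  refine ⟨t, u + v₀ + v₁ + b₀ + b₁ + t + 1, E₀ ++ F₀, E₁ ++ F₁, ht.1, ht.2, by omega,
    extendsWithOne_of_mem le_rfl (fun z hz => (h₀ z hz).2) (by omega) hF₀
      (fun z hz => (hb₀ z hz).trans_le (by omega))
      (hv₀.congr (by omega) fun _ _ => Iff.rfl),
    extendsWithOne_of_mem le_rfl (fun z hz => (h₁ z hz).2) (by omega)
      (fun z hz => (hF₁ z hz).1) (fun z hz => (hb₁ z hz).trans_le (by omega))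
      (hv₁.congr (by omega) fun _ _ => Iff.rfl)⟩

/-- Step `n` adds only elements `≥ u n`, so the chain is frozen below `u m` from `m` on and
computations with use at most `u m` persist. -/
theorem mem_append_iff_of_chain {u : ℕ → ℕ} (hu : Monotone u) (K : List ℕ) {E : ℕ → List ℕ}
    (hE : ∀ n, ∀ z ∈ E n, z ∈ E (n + 1)) (hE' : ∀ n, ∀ z ∈ E (n + 1), z ∈ E n ∨ u n ≤ z)
    (m n : ℕ) (hmn : m ≤ n) : ∀ z < u m, z ∈ listSet (K ++ E m) ↔ z ∈ listSet (K ++ E n) := by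
  intro z hz
  have : z ∈ E m ↔ z ∈ E n := by
    induction n, hmn using Nat.le_induction with
    | base => rfl
    | succ n hmn ih =>
      refine ih.trans ⟨hE n z, fun h => (hE' n z h).resolve_right fun h' => ?_⟩
      exact absurd (hz.trans_le (hu hmn)) (not_lt.2 h')
  simp [this]

theorem exists_refines_forces (hS : Sigma1 fun z => z ∈ R) (hR : Refines D R D R) (i j : ℕ)
    (K : List ℕ) : ∃ D' R', (Sigma1 fun z => z ∈ R') ∧ Refines D R D' R' ∧
      (ForcesDisagreement i j K D' R' ∨ ForcesDisjoint i D' R' ∨ ForcesDivergence j K R') := by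
  by_cases hno : ∃ D' R', (Sigma1 fun z => z ∈ R') ∧ Refines D R D' R' ∧ ForcesDisjoint i D' R'
  · obtain ⟨D', R', h1, h2, h3⟩ := hno
    exact ⟨D', R', h1, h2, Or.inr (Or.inl h3)⟩
  replace hno : ∀ D' R', (Sigma1 fun z => z ∈ R') → Refines D R D' R' → ¬ ForcesDisjoint i D' R' :=
    fun D' R' h1 h2 h3 => hno ⟨D', R', h1, h2, h3⟩
  obtain ⟨a, -, ha⟩ := hR.unbounded 0
  have haD : a ∉ D := fun h => lt_irrefl a (hR.lt a ha a h)
  -- a state `((E₀, E₁), t, u)`: the two finite sets, the last common element, and a bound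
  let P : (List ℕ × List ℕ) × ℕ × ℕ → (List ℕ × List ℕ) × ℕ × ℕ → Prop := fun s s' =>
    (s'.2.1 ∈ R ∧ s.2.2 ≤ s'.2.1 ∧ s'.2.1 < s'.2.2) ∧
      ExtendsWithOne i (a :: D) R s.1.1 s.2.2 s'.1.1 s'.2.1 s'.2.2 ∧
      ExtendsWithOne i D R s.1.2 s.2.2 s'.1.2 s'.2.1 s'.2.2
  let Inv : (List ℕ × List ℕ) × ℕ × ℕ → Prop := fun s =>
    (∀ z ∈ s.1.1, (z ∈ R ∧ a < z) ∧ z < s.2.2) ∧ (∀ z ∈ s.1.2, (z ∈ R ∧ a < z) ∧ z < s.2.2) ∧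
      a < s.2.2
  have hP : Sigma1 fun q : ((List ℕ × List ℕ) × ℕ × ℕ) × (List ℕ × List ℕ) × ℕ × ℕ =>
      P q.1 q.2 := by
    have hu : Primrec fun q : ((List ℕ × List ℕ) × ℕ × ℕ) × (List ℕ × List ℕ) × ℕ × ℕ =>
      q.1.2.2 := Primrec.snd.comp (Primrec.snd.comp Primrec.fst)
    have htv : Primrec fun q : ((List ℕ × List ℕ) × ℕ × ℕ) × (List ℕ × List ℕ) × ℕ × ℕ =>
      q.2.2 := Primrec.snd.comp Primrec.snd
    have hEE : Primrec fun q : ((List ℕ × List ℕ) × ℕ × ℕ) × (List ℕ × List ℕ) × ℕ × ℕ =>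
      q.1.1 := Primrec.fst.comp Primrec.fst
    have hEE' : Primrec fun q : ((List ℕ × List ℕ) × ℕ × ℕ) × (List ℕ × List ℕ) × ℕ × ℕ =>
      q.2.1 := Primrec.fst.comp Primrec.snd
    refine Sigma1.and (Sigma1.and (hS.comp (Primrec.fst.comp htv)) (.of_primrec (PrimrecPred.and
      (Primrec.nat_le.comp hu (Primrec.fst.comp htv))
      (Primrec.nat_lt.comp (Primrec.fst.comp htv) (Primrec.snd.comp htv))))) (Sigma1.and ?_ ?_)
    · exact (sigma1_extendsWithOne i (a :: D) hS).comp
        (((Primrec.fst.comp hEE).pair hu).pair ((Primrec.fst.comp hEE').pair htv))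
    · exact (sigma1_extendsWithOne i D hS).comp
        (((Primrec.snd.comp hEE).pair hu).pair ((Primrec.snd.comp hEE').pair htv))
  -- The initial bound `a + 1` keeps all new elements above `a`, so that the second side never
  -- acquires `a`.
  obtain ⟨f, hf0, hInv, hf, hfS⟩ := exists_sigma1_sequence hP Inv (a₀ := (([], []), 0, a + 1))
    ⟨by simp, by simp, Nat.lt_succ_self a⟩
    (by
      rintro ⟨⟨E₀, E₁⟩, t, u⟩ ⟨h0, h1, hau⟩
      obtain ⟨t', v, E₀', E₁', h⟩ := exists_common_extension hS hR hno ha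
        (fun z hz => ⟨(h0 z hz).1.1, (h0 z hz).2⟩) (fun z hz => ⟨(h1 z hz).1.1, (h1 z hz).2⟩) hau
      exact ⟨((E₀', E₁'), t', v), ⟨h.1, h.2.1, h.2.2.1⟩, h.2.2.2⟩)
    (by
      rintro s s' ⟨h0, h1, hau⟩ ⟨⟨_, h2, h3⟩, ⟨_, h4, _⟩, ⟨_, h5, _⟩⟩
      refine ⟨fun z hz => ⟨?_, (h4 z hz).2⟩, fun z hz => ⟨?_, (h5 z hz).2⟩, by omega⟩
      · exact (h4 z hz).1.elim (fun h => (h0 z h).1) fun h => ⟨h.1, by omega⟩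
      · exact (h5 z hz).1.elim (fun h => (h1 z h).1) fun h => ⟨h.1, by omega⟩)
  let u : ℕ → ℕ := fun n => (f n).2.2
  let t : ℕ → ℕ := fun n => (f (n + 1)).2.1
  have hut : ∀ n, u n ≤ t n := fun n => (hf n).1.2.1
  have htu : ∀ n, t n < u (n + 1) := fun n => (hf n).1.2.2
  have hu : StrictMono u := strictMono_nat_of_lt_succ fun n => (hut n).trans_lt (htu n)
  have hau : ∀ n, a < u n := fun n => (hInv n).2.2
  have hnt : ∀ n, n ≤ t n := fun n => hu.le_apply.trans (hut n)
  -- If no finite set of common elements yields a value at `a`, the set of all common elements is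
  -- itself the reservoir that forces divergence.
  by_cases hdiv : ∀ (F : List ℕ) (y : ℕ), (∀ z ∈ F, z ∈ Set.range t) →
      y ∉ turingFunctional j (listSet (K ++ F)) a
  · refine ⟨D, Set.range t, ?_, ⟨fun _ => id, fun _ => Or.inl, ?_, fun n => ⟨t n, hnt n, n, rfl⟩, ?_⟩,
      Or.inr (Or.inr ⟨a, hdiv⟩)⟩
    · refine (Sigma1.ex (P := fun (z : ℕ) (q : ℕ × (List ℕ × List ℕ) × ℕ × ℕ) =>
        f (q.1 + 1) = q.2 ∧ q.2.2.1 = z) (Sigma1.and ?_ (.of_primrec ?_))).of_eq fun z => ?_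
      · exact hfS.comp (f := fun p : ℕ × ℕ × (List ℕ × List ℕ) × ℕ × ℕ => (p.2.1 + 1, p.2.2))
          ((Primrec.succ.comp (Primrec.fst.comp Primrec.snd)).pair
            (Primrec.snd.comp Primrec.snd))
      · exact Primrec.eq.comp (Primrec.fst.comp (Primrec.snd.comp
          (Primrec.snd.comp Primrec.snd))) Primrec.fst
      · constructor
        · rintro ⟨q, h1, h2⟩
          exact ⟨q.1, by rw [← h2, ← h1]⟩
        · rintro ⟨n, rfl⟩
          exact ⟨(n, f (n + 1)), rfl, rfl⟩
    · rintro _ ⟨n, rfl⟩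
      exact (hf n).1.1
    · rintro _ ⟨n, rfl⟩ d hd
      exact hR.lt _ (hf n).1.1 d hd
  push Not at hdiv
  obtain ⟨F, y, hF, hy⟩ := hdiv
  -- Since `m ≤ t m`, a bound on `F` bounds the indices of its elements too, so on both sides the
  -- computations for `F` have use at most `u n`.
  obtain ⟨n, hn⟩ := F.exists_forall_mem_lt
  have hFn : ∀ z ∈ F, ∃ m < n, t m = z := by
    intro z hz
    obtain ⟨m, rfl⟩ := hF z hz
    exact ⟨m, (hnt m).trans_lt (hn _ hz), rfl⟩
  have agree₀ := mem_append_iff_of_chain hu.monotone (a :: D) (E := fun n => (f n).1.1)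
    (fun n => (hf n).2.1.1) fun n z hz => ((hf n).2.1.2.1 z hz).1.imp_right And.right
  have agree₁ := mem_append_iff_of_chain hu.monotone D (E := fun n => (f n).1.2)
    (fun n => (hf n).2.2.1) fun n z hz => ((hf n).2.2.2.1 z hz).1.imp_right And.right
  have hlt : ∀ z ∈ tailFrom R (u n), u n ≤ z := fun z hz => hz.2
  -- The value `1` at `a` is refuted by the side that omits `a`, any other value by the side that
  -- contains it.
  by_cases hy1 : y = 1
  · refine ⟨D ++ (f n).1.2, tailFrom R (u n), sigma1_tailFrom hS _, ⟨fun z hz => by simp [hz],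
      fun z hz => ?_, fun z hz => hz.1, tailFrom_unbounded hR.unbounded _, fun z hz d hd => ?_⟩,
      Or.inl ⟨F, a, u n, y, fun z hz => ?_, hlt, hy, Or.inr ⟨fun h => ?_, hau n, by omega⟩⟩⟩
    · exact (List.mem_append.1 hz).imp_right fun h => ((hInv n).2.1 z h).1.1
    · rcases List.mem_append.1 hd with hd | hd
      exacts [hR.lt z hz.1 d hd, ((hInv n).2.1 d hd).2.trans_le hz.2]
    · obtain ⟨m, hm, rfl⟩ := hFn z hz
      exact (hf m).2.2.2.2.congr (hu.monotone hm) (agree₁ _ _ hm)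
    · rcases List.mem_append.1 h with h | h
      exacts [haD h, lt_irrefl a ((hInv n).2.1 a h).1.2]
  · refine ⟨a :: D ++ (f n).1.1, tailFrom R (u n), sigma1_tailFrom hS _, ⟨fun z hz => by simp [hz],
      fun z hz => ?_, fun z hz => hz.1, tailFrom_unbounded hR.unbounded _, fun z hz d hd => ?_⟩,
      Or.inl ⟨F, a, u n, y, fun z hz => ?_, hlt, hy, Or.inl ⟨by simp, hy1⟩⟩⟩
    · simp only [List.cons_append, List.mem_cons, List.mem_append] at hz
      rcases hz with rfl | hz | hz
      exacts [Or.inr ha, Or.inl hz, Or.inr ((hInv n).1 z hz).1.1]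
    · simp only [List.cons_append, List.mem_cons, List.mem_append] at hd
      rcases hd with rfl | hd | hd
      exacts [(hau n).trans_le hz.2, hR.lt z hz.1 d hd, ((hInv n).1 d hd).2.trans_le hz.2]
    · obtain ⟨m, hm, rfl⟩ := hFn z hz
      exact (hf m).2.1.2.2.congr (hu.monotone hm) (agree₀ _ _ hm)

end Density

/-! ### A generic set -/

/-- The costly clauses are the inclusion of one c.e. set in another and the unboundedness of a c.e.
set; both are `Pi2`. -/
theorem pi2_refines : Pi2 fun q : (List ℕ × Nat.Partrec.Code) × List ℕ × Nat.Partrec.Code =>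
    Refines q.1.1 (codeDom q.1.2) q.2.1 (codeDom q.2.2) := by
  have hD : Primrec fun q : (List ℕ × Nat.Partrec.Code) × List ℕ × Nat.Partrec.Code => q.1.1 :=
    Primrec.fst.comp Primrec.fst
  have hc : Primrec fun q : (List ℕ × Nat.Partrec.Code) × List ℕ × Nat.Partrec.Code => q.1.2 :=
    Primrec.snd.comp Primrec.fst
  have hD' : Primrec fun q : (List ℕ × Nat.Partrec.Code) × List ℕ × Nat.Partrec.Code => q.2.1 :=
    Primrec.fst.comp Primrec.snd
  have hc' : Primrec fun q : (List ℕ × Nat.Partrec.Code) × List ℕ × Nat.Partrec.Code => q.2.2 :=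
    Primrec.snd.comp Primrec.snd
  have hmem {γ : Type} [Primcodable γ] {c : γ → Nat.Partrec.Code} {z : γ → ℕ} (hc : Primrec c)
      (hz : Primrec z) : Sigma1 fun a => z a ∈ codeDom (c a) :=
    sigma1_mem_codeDom.comp (hc.pair hz)
  have h1 := Sigma1.forall_mem (P := fun q z => z ∈ q.2.1)
    (.of_primrec (PrimrecPred.mem_list Primrec.snd (hD'.comp Primrec.fst))) hD
  have h2 := Sigma1.forall_mem (P := fun q z => z ∈ q.1.1 ∨ z ∈ codeDom q.1.2)
    (Sigma1.or (.of_primrec (PrimrecPred.mem_list Primrec.snd (hD.comp Primrec.fst)))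
      (hmem (hc.comp Primrec.fst) Primrec.snd)) hD'
  have h3 := Pi2.all (P := fun (q : (List ℕ × Nat.Partrec.Code) × List ℕ × Nat.Partrec.Code)
      (z : ℕ) => z ∈ codeDom q.2.2 → z ∈ codeDom q.1.2)
    (Pi2.imp (hmem (hc'.comp Primrec.fst) Primrec.snd)
      (.of_sigma1 (hmem (hc.comp Primrec.fst) Primrec.snd)))
  have h4 := Pi2.all_sigma1 (P := fun (q : (List ℕ × Nat.Partrec.Code) × List ℕ ×
      Nat.Partrec.Code) (n : ℕ) => ∃ z, n ≤ z ∧ z ∈ codeDom q.2.2)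
    (Sigma1.ex (P := fun (p : ((List ℕ × Nat.Partrec.Code) × List ℕ × Nat.Partrec.Code) × ℕ)
      (z : ℕ) => p.2 ≤ z ∧ z ∈ codeDom p.1.2.2)
      (Sigma1.and (.of_primrec (Primrec.nat_le.comp (Primrec.snd.comp Primrec.fst) Primrec.snd))
        (hmem (hc'.comp (Primrec.fst.comp Primrec.fst)) Primrec.snd)))
  have h5 := Pi2.all (P := fun (q : (List ℕ × Nat.Partrec.Code) × List ℕ × Nat.Partrec.Code)
      (z : ℕ) => z ∈ codeDom q.2.2 → ∀ d ∈ q.2.1, d < z)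
    (Pi2.imp (hmem (hc'.comp Primrec.fst) Primrec.snd) (.of_sigma1
      (Sigma1.forall_mem (P := fun (p : ((List ℕ × Nat.Partrec.Code) × List ℕ ×
        Nat.Partrec.Code) × ℕ) (d : ℕ) => d < p.2)
        (.of_primrec (Primrec.nat_lt.comp Primrec.snd (Primrec.snd.comp Primrec.fst)))
        (hD'.comp Primrec.fst))))
  exact ((Pi2.of_sigma1 (h1.and h2)).and (h3.and (h4.and h5))).of_eq fun q =>
    ⟨fun ⟨⟨h1, h2⟩, h3, h4, h5⟩ => ⟨h1, h2, h3, h4, h5⟩,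
      fun ⟨h1, h2, h3, h4, h5⟩ => ⟨⟨h1, h2⟩, h3, h4, h5⟩⟩

/-! ### Complexity of meeting a requirement -/

section Requirements

variable {γ : Type*} [Primcodable γ] {i j : γ → ℕ} {K D : γ → List ℕ} {c : γ → Nat.Partrec.Code}

theorem sigma1_mem_turingFunctional_comp {x y : γ → ℕ} (hi : Primrec i) (hD : Primrec D)
    (hx : Primrec x) (hy : Primrec y) :
    Sigma1 fun a => y a ∈ turingFunctional (i a) (listSet (D a)) (x a) :=
  sigma1_mem_turingFunctional.comp (f := fun a => ((i a, D a, x a), y a))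
    ((hi.pair (hD.pair hx)).pair hy)

theorem sigma1_forall_mem_codeDom (hD : Primrec D) (hc : Primrec c) :
    Sigma1 fun a => ∀ z ∈ D a, z ∈ codeDom (c a) :=
  Sigma1.forall_mem (P := fun a z => z ∈ codeDom (c a))
    (sigma1_mem_codeDom.comp ((hc.comp Primrec.fst).pair Primrec.snd)) hD

/-- Under the leading existential quantifiers, the only clause that is not `Sigma1` is that `u`
bounds the c.e. reservoir from below. -/
theorem sigma3_forcesDisagreement (hi : Primrec i) (hj : Primrec j) (hK : Primrec K)
    (hD : Primrec D) (hc : Primrec c) :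
    Sigma3 fun a => ForcesDisagreement (i a) (j a) (K a) (D a) (codeDom (c a)) := by
  have hx : Primrec fun p : γ × List ℕ × ℕ × ℕ × ℕ => p.2.2.1 :=
    Primrec.fst.comp (Primrec.snd.comp Primrec.snd)
  have hu : Primrec fun p : γ × List ℕ × ℕ × ℕ × ℕ => p.2.2.2.1 :=
    Primrec.fst.comp (Primrec.snd.comp (Primrec.snd.comp Primrec.snd))
  have hy : Primrec fun p : γ × List ℕ × ℕ × ℕ × ℕ => p.2.2.2.2 :=
    Primrec.snd.comp (Primrec.snd.comp (Primrec.snd.comp Primrec.snd))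
  have hF : Primrec fun p : γ × List ℕ × ℕ × ℕ × ℕ => p.2.1 := Primrec.fst.comp Primrec.snd
  have hxD := PrimrecPred.mem_list hx (hD.comp Primrec.fst)
  have h := Sigma3.exists_pi2 (P := fun (a : γ) (w : List ℕ × ℕ × ℕ × ℕ) =>
    (∀ t ∈ w.1, HaltsBefore (i a) (listSet (D a)) t w.2.2.1 1) ∧
    (∀ z, z ∈ codeDom (c a) → w.2.2.1 ≤ z) ∧
    w.2.2.2 ∈ turingFunctional (j a) (listSet (K a ++ w.1)) w.2.1 ∧
    ((w.2.1 ∈ D a ∧ w.2.2.2 ≠ 1) ∨ (w.2.1 ∉ D a ∧ w.2.1 < w.2.2.1 ∧ w.2.2.2 ≠ 0)))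
    (Pi2.and (.of_sigma1 (Sigma1.forall_mem (P := fun (p : γ × List ℕ × ℕ × ℕ × ℕ) t =>
      HaltsBefore (i p.1) (listSet (D p.1)) t p.2.2.2.1 1) (.of_primrec
        (primrecPred_haltsBefore.comp
          (f := fun q : (γ × List ℕ × ℕ × ℕ × ℕ) × ℕ => ((i q.1.1, D q.1.1, q.2), q.1.2.2.2.1, 1))
          (((hi.comp (Primrec.fst.comp Primrec.fst)).pair
            ((hD.comp (Primrec.fst.comp Primrec.fst)).pair Primrec.snd)).pair
            ((hu.comp Primrec.fst).pair (Primrec.const 1))))) hF))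
    (Pi2.and (Pi2.all (P := fun (p : γ × List ℕ × ℕ × ℕ × ℕ) z =>
        z ∈ codeDom (c p.1) → p.2.2.2.1 ≤ z)
      (Pi2.imp (sigma1_mem_codeDom.comp
        ((hc.comp (Primrec.fst.comp Primrec.fst)).pair Primrec.snd))
        (.of_sigma1 (.of_primrec (Primrec.nat_le.comp (hu.comp Primrec.fst) Primrec.snd)))))
    (Pi2.of_sigma1 (Sigma1.and
      (sigma1_mem_turingFunctional_comp (hj.comp Primrec.fst)
        (Primrec.list_append.comp (hK.comp Primrec.fst) hF) hx hy)
      (.of_primrec (PrimrecPred.or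
        (hxD.and (Primrec.eq.comp hy (Primrec.const 1)).not)
        (hxD.not.and ((Primrec.nat_lt.comp hx hu).and
          (Primrec.eq.comp hy (Primrec.const 0)).not))))))))
  exact h.of_eq fun a => by simp only [ForcesDisagreement, Prod.exists]

theorem sigma3_forcesDisjoint (hi : Primrec i) (hD : Primrec D) (hc : Primrec c) :
    Sigma3 fun a => ForcesDisjoint (i a) (D a) (codeDom (c a)) := by
  have hE : Primrec fun p : γ × List ℕ × ℕ => p.2.1 := Primrec.fst.comp Primrec.snd
  have ht : Primrec fun p : γ × List ℕ × ℕ => p.2.2 := Primrec.snd.comp Primrec.snd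
  refine (Sigma3.of_pi2 (Pi2.all (P := fun (a : γ) (w : List ℕ × ℕ) =>
    (∀ z ∈ w.1, z ∈ codeDom (c a)) → w.2 ∈ codeDom (c a) →
      1 ∉ turingFunctional (i a) (listSet (D a ++ w.1)) w.2)
    (Pi2.imp (sigma1_forall_mem_codeDom hE (hc.comp Primrec.fst))
      (Pi2.imp (sigma1_mem_codeDom.comp ((hc.comp Primrec.fst).pair ht))
        (Pi2.of_not_sigma1 (sigma1_mem_turingFunctional_comp (hi.comp Primrec.fst)
          (Primrec.list_append.comp (hD.comp Primrec.fst) hE) ht (Primrec.const 1))))))).of_eq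
    fun a => by simp only [ForcesDisjoint, Prod.forall]

theorem sigma3_forcesDivergence (hj : Primrec j) (hK : Primrec K) (hc : Primrec c) :
    Sigma3 fun a => ForcesDivergence (j a) (K a) (codeDom (c a)) := by
  have ha : Primrec fun p : (γ × ℕ) × List ℕ × ℕ => p.1.1 := Primrec.fst.comp Primrec.fst
  have hF : Primrec fun p : (γ × ℕ) × List ℕ × ℕ => p.2.1 := Primrec.fst.comp Primrec.snd
  refine (Sigma3.exists_pi2 (P := fun (a : γ) (x : ℕ) => ∀ w : List ℕ × ℕ,
    (∀ z ∈ w.1, z ∈ codeDom (c a)) → w.2 ∉ turingFunctional (j a) (listSet (K a ++ w.1)) x)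
    (Pi2.all (P := fun (p : γ × ℕ) (w : List ℕ × ℕ) => (∀ z ∈ w.1, z ∈ codeDom (c p.1)) →
      w.2 ∉ turingFunctional (j p.1) (listSet (K p.1 ++ w.1)) p.2)
      (Pi2.imp (sigma1_forall_mem_codeDom hF (hc.comp ha))
        (Pi2.of_not_sigma1 (sigma1_mem_turingFunctional_comp (hj.comp ha)
          (Primrec.list_append.comp (hK.comp ha) hF) (Primrec.snd.comp Primrec.fst)
          (Primrec.snd.comp Primrec.snd)))))).of_eq
    fun a => by simp only [ForcesDivergence, Prod.forall]

end Requirements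

/-- The requirement with number `n`: two indices and a finite set. -/
def requirement (n : ℕ) : ℕ × ℕ × List ℕ :=
  (Encodable.decode n : Option (ℕ × ℕ × List ℕ)).getD (0, 0, [])

theorem primrec_requirement : Primrec requirement :=
  Primrec.option_getD.comp Primrec.decode (Primrec.const _)

theorem requirement_encode (e : ℕ × ℕ × List ℕ) : requirement (Encodable.encode e) = e := by
  rw [requirement, Encodable.encodek, Option.getD_some]

/-- The condition `(D, R)` meets the requirement given by `i`, `j` and `K`. -/
def ForcesRequirement (e : ℕ × ℕ × List ℕ) (D : List ℕ) (R : Set ℕ) : Prop :=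
  ForcesDisagreement e.1 e.2.1 e.2.2 D R ∨ ForcesDisjoint e.1 D R ∨ ForcesDivergence e.2.1 e.2.2 R

/-- The condition `q` extends `p`, meets the `n`-th requirement, and has an element
that is at least `n`. -/
def GenericStep (n : ℕ) (p q : List ℕ × Nat.Partrec.Code) : Prop :=
  Refines p.1 (codeDom p.2) q.1 (codeDom q.2) ∧ (∃ d, d ∈ q.1 ∧ n ≤ d) ∧
    ForcesRequirement (requirement n) q.1 (codeDom q.2)

theorem sigma3_genericStep :
    Sigma3 fun z : (ℕ × List ℕ × Nat.Partrec.Code) × List ℕ × Nat.Partrec.Code =>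
      GenericStep z.1.1 z.1.2 z.2 := by
  have hn : Primrec fun z : (ℕ × List ℕ × Nat.Partrec.Code) × List ℕ × Nat.Partrec.Code =>
    z.1.1 := Primrec.fst.comp Primrec.fst
  have he : Primrec fun z : (ℕ × List ℕ × Nat.Partrec.Code) × List ℕ × Nat.Partrec.Code =>
    requirement z.1.1 := primrec_requirement.comp hn
  have hi := Primrec.fst.comp he
  have hj := Primrec.fst.comp (Primrec.snd.comp he)
  have hK := Primrec.snd.comp (Primrec.snd.comp he)
  have hD : Primrec fun z : (ℕ × List ℕ × Nat.Partrec.Code) × List ℕ × Nat.Partrec.Code =>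
    z.2.1 := Primrec.fst.comp Primrec.snd
  have hc : Primrec fun z : (ℕ × List ℕ × Nat.Partrec.Code) × List ℕ × Nat.Partrec.Code =>
    z.2.2 := Primrec.snd.comp Primrec.snd
  refine Sigma3.and (.of_pi2 (pi2_refines.comp
      (f := fun z : (ℕ × List ℕ × Nat.Partrec.Code) × List ℕ × Nat.Partrec.Code => (z.1.2, z.2))
      ((Primrec.snd.comp Primrec.fst).pair Primrec.snd)))
    (Sigma3.and (.of_sigma1 (Sigma1.exists_primrec
      (R := fun (z : (ℕ × List ℕ × Nat.Partrec.Code) × List ℕ × Nat.Partrec.Code) (d : ℕ) =>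
        d ∈ z.2.1 ∧ z.1.1 ≤ d)
      (PrimrecPred.and (PrimrecPred.mem_list Primrec.snd (hD.comp Primrec.fst))
        (Primrec.nat_le.comp (hn.comp Primrec.fst) Primrec.snd))))
    ((sigma3_forcesDisagreement hi hj hK hD hc).or
      ((sigma3_forcesDisjoint hi hD hc).or (sigma3_forcesDivergence hj hK hc))))

theorem exists_genericStep (n : ℕ) {p : List ℕ × Nat.Partrec.Code}
    (hp : Refines p.1 (codeDom p.2) p.1 (codeDom p.2)) : ∃ q, GenericStep n p q := by
  have hS : Sigma1 fun z => z ∈ codeDom p.2 :=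
    sigma1_mem_codeDom.comp (f := fun z => (p.2, z)) ((Primrec.const _).pair Primrec.id)
  obtain ⟨d, hnd, hd⟩ := hp.unbounded n
  -- First `d ≥ n` enters the finite part and the reservoir is cut above it; density is then applied
  -- to the result.
  have h1 : Refines p.1 (codeDom p.2) (d :: p.1) (tailFrom (codeDom p.2) (d + 1)) := by
    refine ⟨fun z hz => by simp [hz], fun z hz => ?_, fun z hz => hz.1,
      tailFrom_unbounded hp.unbounded _, fun z hz b hb => ?_⟩
    · rcases List.mem_cons.1 hz with rfl | hz
      exacts [Or.inr hd, Or.inl hz]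
    · rcases List.mem_cons.1 hb with rfl | hb
      exacts [hz.2, hp.lt z hz.1 b hb]
  have h2 : Refines (d :: p.1) (tailFrom (codeDom p.2) (d + 1)) (d :: p.1)
      (tailFrom (codeDom p.2) (d + 1)) :=
    ⟨fun _ => id, fun _ => Or.inl, fun _ => id, h1.unbounded, h1.lt⟩
  obtain ⟨D', R', hR', h3, h4⟩ := exists_refines_forces (sigma1_tailFrom hS _) h2
    (requirement n).1 (requirement n).2.1 (requirement n).2.2
  obtain ⟨c, rfl⟩ := exists_codeDom_eq hR'
  exact ⟨(D', c), h1.trans h3, ⟨d, h3.subset d (by simp), hnd⟩, h4⟩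

/-- There is an infinite `Δ⁰₃` set that satisfies, for each requirement, a condition meeting it. -/
theorem exists_isDelta_three_generic : ∃ G : Set ℕ, IsDelta ∅ 3 G ∧ (∀ n, ∃ z, n ≤ z ∧ z ∈ G) ∧
    ∀ e, ∃ (D : List ℕ) (R : Set ℕ), (∀ z ∈ D, z ∈ G) ∧ (∀ z ∈ G, z ∈ D ∨ z ∈ R) ∧
      ForcesRequirement e D R := by
  obtain ⟨c₀, hc₀⟩ := exists_codeDom_eq (R := Set.univ)
    (.of_primrec ((Primrec.eq.comp (Primrec.const 0) (Primrec.const 0)).of_eq fun z => by simp))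
  obtain ⟨f, -, hInv, hf, hfS⟩ := exists_sigma3_sequence sigma3_genericStep
    (fun p => Refines p.1 (codeDom p.2) p.1 (codeDom p.2)) (a₀ := (([] : List ℕ), c₀))
    ⟨fun _ => id, fun _ => Or.inl, fun _ => id, fun n => ⟨n, le_rfl, by simp [hc₀]⟩, by simp⟩
    (fun n p hp => exists_genericStep n hp)
    (fun n p q _ h => ⟨fun _ => id, fun _ => Or.inl, fun _ => id, h.1.unbounded, h.1.lt⟩)
  have hmono : ∀ m n, m ≤ n → Refines (f m).1 (codeDom (f m).2) (f n).1 (codeDom (f n).2) := by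
    intro m n hmn
    induction n, hmn using Nat.le_induction with
    | base => exact hInv m
    | succ n hmn ih => exact ih.trans (hf n).1
  let G : Set ℕ := {z | ∃ n, z ∈ (f n).1}
  have hsub : ∀ n, ∀ z ∈ (f n).1, z ∈ G := fun n z hz => ⟨n, hz⟩
  have hsat : ∀ n, ∀ z ∈ G, z ∈ (f n).1 ∨ z ∈ codeDom (f n).2 := by
    rintro n z ⟨m, hm⟩
    rcases le_total m n with h | h
    · exact Or.inl ((hmono m n h).subset z hm)
    · exact (hmono n m h).mem_or z hm
  -- The finite part at stage `m + 1` has an element `d ≥ m` and the reservoir lies above `d`, so a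
  -- number `z ≤ m` absent at this stage never enters. This gives the complement a `Sigma3`
  -- definition.
  have hcompl : ∀ z, z ∈ Gᶜ ↔ ∃ q : ℕ × List ℕ × Nat.Partrec.Code,
      f q.1 = q.2 ∧ z < q.1 ∧ z ∉ q.2.1 := by
    intro z
    constructor
    · intro hz
      exact ⟨(z + 1, f (z + 1)), rfl, Nat.lt_succ_self z, fun h => hz (hsub _ z h)⟩
    · rintro ⟨⟨n, p⟩, hq, hzn, hz⟩ hzG
      obtain rfl : f n = p := hq
      change z < n at hzn
      obtain ⟨m, rfl⟩ := Nat.exists_eq_succ_of_ne_zero (Nat.ne_zero_of_lt hzn)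
      obtain ⟨-, ⟨d, hd, hmd⟩, -⟩ := hf m
      have h1 := (hsat _ z hzG).resolve_left hz
      have h2 := (hInv _).lt z h1 d hd
      omega
  have hgraph : Sigma3 fun p : ℕ × ℕ × List ℕ × Nat.Partrec.Code => f p.2.1 = p.2.2 :=
    hfS.comp Primrec.snd
  have hmem : PrimrecPred fun p : ℕ × ℕ × List ℕ × Nat.Partrec.Code => p.1 ∈ p.2.2.1 :=
    PrimrecPred.mem_list Primrec.fst (Primrec.fst.comp (Primrec.snd.comp Primrec.snd))
  refine ⟨G, ⟨Sigma3.isSigma ?_, Sigma3.isSigma ?_⟩, fun n => ?_, fun e => ?_⟩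
  · refine (Sigma3.ex (P := fun (z : ℕ) (q : ℕ × List ℕ × Nat.Partrec.Code) =>
      f q.1 = q.2 ∧ z ∈ q.2.1) (hgraph.and (.of_primrec hmem))).of_eq fun z => ?_
    constructor
    · rintro ⟨q, hq, hz⟩
      exact ⟨q.1, hq ▸ hz⟩
    · rintro ⟨n, hz⟩
      exact ⟨(n, f n), rfl, hz⟩
  · exact (Sigma3.ex (P := fun (z : ℕ) (q : ℕ × List ℕ × Nat.Partrec.Code) =>
      f q.1 = q.2 ∧ z < q.1 ∧ z ∉ q.2.1) (hgraph.and (.of_primrec ((Primrec.nat_lt.comp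
        Primrec.fst (Primrec.fst.comp Primrec.snd)).and hmem.not)))).of_eq fun z => (hcompl z).symm
  · obtain ⟨-, ⟨d, hd, hnd⟩, -⟩ := hf n
    exact ⟨d, hnd, hsub _ d hd⟩
  · have h := (hf (Encodable.encode e)).2.2
    rw [requirement_encode] at h
    exact ⟨_, _, hsub _, hsat _, h⟩

/-! ### Generic sets over a Turing ideal -/

theorem SetReducible.tailFrom {S X : Set ℕ} (h : S ≤ₛ X) (k : ℕ) : tailFrom S k ≤ₛ X := by
  refine RecursiveIn.iff_nat.2 ?_
  have h1 : Nat.RecursiveIn {charFun X} fun n => ((if k ≤ n then 1 else 0 : ℕ) : Part ℕ) :=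
    Nat.Primrec.recursiveIn (Primrec.nat_iff.1 (Primrec.ite (Primrec.nat_le.comp (Primrec.const k)
      Primrec.id) (Primrec.const 1) (Primrec.const 0)))
  have h2 : Nat.RecursiveIn {charFun X} fun z => ((z.unpair.1 * z.unpair.2 : ℕ) : Part ℕ) :=
    Nat.Primrec.recursiveIn (Primrec.nat_iff.1 (Primrec.nat_mul.comp
      (Primrec.fst.comp Primrec.unpair) (Primrec.snd.comp Primrec.unpair)))
  refine (h2.comp (h1.pair (RecursiveIn.iff_nat.1 h))).of_eq fun n => ?_
  by_cases hk : k ≤ n <;> by_cases hn : n ∈ S <;> simp [charFun, Seq.seq, hk, hn]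

theorem countable_setOf_setReducible (X : Set ℕ) : {P : Set ℕ | P ≤ₛ X}.Countable := by
  classical
  refine (Set.countable_range fun e => {n | turingFunctional e X n = Part.some 1}).mono ?_
  intro P hP
  obtain ⟨e, he⟩ := exists_turingFunctional hP
  refine ⟨e, Set.ext fun n => ?_⟩
  rw [Set.mem_ofPred_eq, he, charFun]
  by_cases hn : n ∈ P <;> simp [hn, Part.some_inj]

theorem countable_setOf_isSigma (X : Set ℕ) (n : ℕ) : {P : Set ℕ | IsSigma X n P}.Countable := by
  induction n with
  | zero => exact countable_setOf_setReducible X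
  | succ n ih =>
    refine (ih.image fun Q => {x | ∃ y, Nat.pair x y ∉ Q}).mono ?_
    rintro P ⟨Q, hQ, H⟩
    exact ⟨Q, hQ, Set.ext fun x => (H x).symm⟩

/-- Ensures that some collection is definable at every level, as needed to enumerate them all by
`ℕ`. The two sets are treated together because each level complements the one below. -/
theorem isSigma_empty_and_univ (X : Set ℕ) (n : ℕ) : IsSigma X n ∅ ∧ IsSigma X n Set.univ := by
  induction n with
  | zero =>
    refine ⟨SetReducible.of_primrecPred ?_, SetReducible.of_primrecPred ?_⟩
    · exact (Primrec.eq.comp (Primrec.const 0) (Primrec.const 1)).of_eq fun z => by simp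
    · exact (Primrec.eq.comp (Primrec.const 0) (Primrec.const 0)).of_eq fun z => by simp
  | succ n ih => exact ⟨⟨_, ih.2, by simp⟩, ⟨_, ih.1, by simp⟩⟩

theorem MathiasExtends.refl (c : Finset ℕ × Set ℕ) : MathiasExtends c c :=
  ⟨fun _ => id, fun _ => Or.inl, fun _ => id⟩

theorem MathiasExtends.trans {c c' c'' : Finset ℕ × Set ℕ} (h : MathiasExtends c'' c')
    (h' : MathiasExtends c' c) : MathiasExtends c'' c :=
  ⟨h'.1.trans h.1, fun _ hz => (h.2.1 hz).elim (fun hz => h'.2.1 hz) fun hz => Or.inr (h'.2.2 hz),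
    h.2.2.trans h'.2.2⟩

namespace TuringIdeal

theorem countable_setOf_isSigmaDefinable (I : TuringIdeal) (n : ℕ) :
    {C | I.IsSigmaDefinable n C}.Countable := by
  refine ((countable_setOf_isSigma (setJoin I.left I.right) n).image fun W =>
    {c | c ∈ I.conditions ∧ ∃ i ∈ W, I.IsIndex i c}).mono ?_
  rintro C ⟨W, hW, rfl⟩
  exact ⟨W, hW, rfl⟩

/-- For countably many sets of conditions that are dense below a condition `c₀`, there is a set
that satisfies a condition in each of them. -/
theorem exists_satisfies_of_dense (I : TuringIdeal) {c₀ : Finset ℕ × Set ℕ}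
    (h₀ : c₀ ∈ I.conditions) (𝒟 : ℕ → Set (Finset ℕ × Set ℕ))
    (hdense : ∀ n, ∀ c ∈ I.conditions, MathiasExtends c c₀ →
      ∃ c' ∈ I.conditions, MathiasExtends c' c ∧ c' ∈ 𝒟 n) :
    ∃ H : Set ℕ, ∀ n, ∃ c ∈ 𝒟 n, c ∈ I.conditions ∧ SatisfiesCondition H c := by
  choose! g hg using hdense
  let f : ℕ → Finset ℕ × Set ℕ := fun n => Nat.rec c₀ (fun n c => g n c) n
  have hf : ∀ n, f n ∈ I.conditions ∧ MathiasExtends (f n) c₀ := by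
    intro n
    induction n with
    | zero => exact ⟨h₀, .refl _⟩
    | succ n ih =>
      have h := hg n _ ih.1 ih.2
      exact ⟨h.1, h.2.1.trans ih.2⟩
  have hstep := fun n => hg n _ (hf n).1 (hf n).2
  have hmono : ∀ m n, m ≤ n → MathiasExtends (f n) (f m) := by
    intro m n hmn
    induction n, hmn using Nat.le_induction with
    | base => exact .refl _
    | succ n hmn ih => exact (hstep n).2.1.trans ih
  refine ⟨{z | ∃ n, z ∈ (f n).1}, fun n => ⟨f (n + 1), (hstep n).2.2, (hf (n + 1)).1,
    fun z hz => ⟨n + 1, hz⟩, ?_⟩⟩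
  rintro z ⟨m, hm⟩
  rcases le_total m (n + 1) with h | h
  · exact Or.inl ((hmono _ _ h).1 hm)
  · exact (hmono _ _ h).2.1 hm

/-- If below some condition no condition forces a generic set to compute `G`, then there is an
`n`-generic set that does not compute `G`. -/
theorem exists_isGeneric_not_setReducible (I : TuringIdeal) {c₀ : Finset ℕ × Set ℕ}
    (h₀ : c₀ ∈ I.conditions) {G : Set ℕ}
    (havoid : ∀ j, ∀ c ∈ I.conditions, MathiasExtends c c₀ →
      ∃ c' ∈ I.conditions, MathiasExtends c' c ∧
        ∀ H, SatisfiesCondition H c' → turingFunctional j H ≠ charFun G) (n : ℕ) :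
    ∃ H, I.IsGeneric n H ∧ ¬ G ≤ₛ H := by
  have hne : {C | I.IsSigmaDefinable n C}.Nonempty :=
    ⟨_, _, (isSigma_empty_and_univ _ n).1, rfl⟩
  obtain ⟨C, hC⟩ := (I.countable_setOf_isSigmaDefinable n).exists_eq_range hne
  -- Each `m` codes two tasks: decide the `m.unpair.1`-th definable collection and defeat the
  -- functional with index `m.unpair.2`.
  let 𝒟 : ℕ → Set (Finset ℕ × Set ℕ) := fun m =>
    {c | (c ∈ C m.unpair.1 ∨ ∀ c' ∈ C m.unpair.1, ¬ MathiasExtends c' c) ∧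
      ∀ H, SatisfiesCondition H c → turingFunctional m.unpair.2 H ≠ charFun G}
  obtain ⟨H, hH⟩ := I.exists_satisfies_of_dense h₀ 𝒟 (by
    intro m c hc hc₀
    obtain ⟨c', hc', hext, hav⟩ := havoid m.unpair.2 c hc hc₀
    -- The functional is defeated first, since this survives a further extension into the
    -- collection.
    by_cases hex : ∃ c'' ∈ C m.unpair.1, MathiasExtends c'' c'
    · obtain ⟨c'', hc'', hext'⟩ := hex
      have hdef : I.IsSigmaDefinable n (C m.unpair.1) := by
        change C m.unpair.1 ∈ {C | I.IsSigmaDefinable n C}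
        rw [hC]
        exact ⟨_, rfl⟩
      obtain ⟨W, -, hW⟩ := hdef
      refine ⟨c'', (hW ▸ hc'' : c'' ∈ {c | c ∈ I.conditions ∧ ∃ i ∈ W, I.IsIndex i c}).1,
        hext'.trans hext, Or.inl hc'', fun H hH => hav H ⟨?_, ?_⟩⟩
      · exact fun z hz => hH.1 (hext'.1 hz)
      · exact fun z hz => (hH.2 hz).elim (fun h => hext'.2.1 h) fun h => Or.inr (hext'.2.2 h)
    · push Not at hex
      exact ⟨c', hc', hext, Or.inr hex, hav⟩)
  refine ⟨H, fun C' hC' => ?_, fun hG => ?_⟩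
  · have hmem : C' ∈ {C | I.IsSigmaDefinable n C} := hC'
    rw [hC] at hmem
    obtain ⟨m, rfl⟩ := hmem
    -- Only the first task matters here, so the functional index `0` is arbitrary.
    obtain ⟨c, hc, hcI, hsat⟩ := hH (Nat.pair m 0)
    simp only [𝒟, Nat.unpair_pair, Set.mem_ofPred_eq] at hc
    exact hc.1.imp (fun h => ⟨c, h, hsat⟩) fun h => ⟨c, hcI, hsat, h⟩
  · obtain ⟨j, hj⟩ := exists_turingFunctional hG
    obtain ⟨c, hc, -, hsat⟩ := hH (Nat.pair 0 j)
    simp only [𝒟, Nat.unpair_pair, Set.mem_ofPred_eq] at hc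
    exact hc.2 H hsat hj

end TuringIdeal

/-! ### From requirements on `G` to extensions of conditions -/

theorem one_mem_charFun {A : Set ℕ} {x : ℕ} : 1 ∈ charFun A x ↔ x ∈ A := by
  classical
  by_cases hx : x ∈ A <;> simp [charFun, hx]

theorem eq_of_mem_charFun {A : Set ℕ} {x y : ℕ} (h : y ∈ charFun A x) :
    (x ∈ A → y = 1) ∧ (x ∉ A → y = 0) := by
  classical
  constructor <;> intro hx <;> simpa [charFun, hx] using h

/-- If `G` satisfies a condition that meets the requirement given by `i`, `j` and `K`, where `Φ_i^G`
is an infinite subset `S` of `G`, then the condition `(K, S)` has an extension with reservoir a tail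
of `S` such that `Φ_j^H ≠ G` for every `H` that satisfies it. -/
theorem exists_extension_avoiding {G S : Set ℕ} {K : Finset ℕ} {i j : ℕ} (hSG : S ⊆ G)
    (hc : IsMathiasCondition (K, S)) (hi : turingFunctional i G = charFun S) {D : List ℕ}
    {R : Set ℕ} (hDG : ∀ z ∈ D, z ∈ G) (hGR : ∀ z ∈ G, z ∈ D ∨ z ∈ R)
    (hreq : ForcesRequirement (i, j, K.toList) D R) :
    ∃ (F : Finset ℕ) (k : ℕ), (↑F ⊆ S) ∧ (∀ z ∈ K ∪ F, z < k) ∧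
      ∀ H, SatisfiesCondition H (K ∪ F, tailFrom S k) → turingFunctional j H ≠ charFun G := by
  obtain ⟨bK, hbK⟩ := K.toList.exists_forall_mem_lt
  obtain ⟨bD, hbD⟩ := D.exists_forall_mem_lt
  simp only [Finset.mem_toList] at hbK
  rcases hreq with ⟨F, x, u, y, hF, hRu, hy, hxy⟩ | hdisj | ⟨x, hx⟩
  -- As `R` starts at `u` or later, `D` and `G` agree below `u`, and computations from `D` with use
  -- at most `u` are computations from `G`.
  · have hagree : ∀ z < u, z ∈ listSet D ↔ z ∈ G := fun z hz =>
      ⟨hDG z, fun h => (hGR z h).resolve_right fun h' => absurd hz (not_lt.2 (hRu z h'))⟩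
    obtain ⟨v, hv⟩ := mem_turingFunctional.1 hy
    obtain ⟨bF, hbF⟩ := F.exists_forall_mem_lt
    -- The new reservoir starts beyond the use `v` of `Φ_j^{K ∪ F}(x)`, so this computation is
    -- preserved for every `H` that satisfies the condition.
    refine ⟨F.toFinset, v + bK + bF, fun z hz => ?_, fun z hz => ?_, fun H hH heq => ?_⟩
    · have hz : z ∈ F := by simpa using hz
      have h1 := (hF z hz).mem hagree
      rw [hi] at h1
      exact one_mem_charFun.1 h1
    · rcases Finset.mem_union.1 hz with hz | hz
      · exact (hbK z hz).trans_le (by omega)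
      · exact (hbF z (List.mem_toFinset.1 hz)).trans_le (by omega)
    · have h1 : y ∈ turingFunctional j H x := by
        refine hv.mem fun z hz => ⟨fun h => hH.1 ?_, fun h => ?_⟩
        · simpa using h
        · rcases hH.2 h with h | h
          · simpa using h
          · exact absurd (h.2 : v + bK + bF ≤ z) (by omega)
      rw [heq] at h1
      have h2 := eq_of_mem_charFun h1
      rcases hxy with ⟨hxD, hy1⟩ | ⟨hxD, hxu, hy0⟩
      · exact hy1 (h2.1 (hDG x hxD))
      · exact hy0 (h2.2 fun hxG => hxD ((hagree x hxu).2 hxG))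
  -- An element `t` of `S` beyond `D` lies in `R`, and the part of `G ∩ R` below the use witnesses
  -- `Φ_i(t) = 1`, against disjointness.
  · exfalso
    obtain ⟨t, htS, htD⟩ := hc.1.exists_gt bD
    have htR : t ∈ R := (hGR t (hSG htS)).resolve_left fun h => absurd (hbD t h) (by omega)
    have h1 : 1 ∈ turingFunctional i G t := by
      rw [hi]
      exact one_mem_charFun.2 htS
    obtain ⟨u, hu⟩ := mem_turingFunctional.1 h1
    classical
    refine hdisj ((List.range u).filter fun z => z ∈ G ∧ z ∈ R) t (fun z hz => ?_) htR
      (hu.mem fun z hz => ?_)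
    · have h : z ∈ G ∧ z ∈ R := by simpa using (List.mem_filter.1 hz).2
      exact h.2
    · simp only [mem_listSet, List.mem_append, List.mem_filter, List.mem_range, decide_eq_true_eq]
      exact ⟨fun h => (hGR z h).imp id fun h' => ⟨hz, h, h'⟩,
        fun h => h.elim (hDG z) fun h' => h'.2.1⟩
  -- Beyond `bD`, elements of `S ⊆ G` are outside `D` and hence in `R`, so `H` adds to `K` only
  -- elements of `R`.
  · refine ⟨∅, bK + bD, by simp, fun z hz => ?_, fun H hH heq => ?_⟩
    · exact (hbK z (by simpa using hz)).trans_le (by omega)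
    · classical
      obtain ⟨y, hy⟩ : ∃ y, y ∈ turingFunctional j H x := by
        rw [heq]
        exact ⟨_, Part.mem_some _⟩
      obtain ⟨u, hu⟩ := mem_turingFunctional.1 hy
      -- A convergent computation from `H` uses only a finite part of `H` outside `K`, and that part
      -- is excluded by the forced divergence.
      refine hx ((List.range u).filter fun z => z ∈ H ∧ z ∉ K) y (fun z hz => ?_)
        (hu.mem fun z hz => ?_)
      · have h : z ∈ H ∧ z ∉ K := by simpa using (List.mem_filter.1 hz).2
        have h1 : z ∈ tailFrom S (bK + bD) := by simpa [h.2] using hH.2 h.1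
        have h2 : bK + bD ≤ z := h1.2
        exact (hGR z (hSG h1.1)).resolve_left fun h => absurd (hbD z h) (by omega)
      · simp only [mem_listSet, List.mem_append, List.mem_filter, List.mem_range,
          decide_eq_true_eq, Finset.mem_toList]
        refine ⟨fun h => ?_, fun h => h.elim (fun h' => hH.1 (by simpa using h')) fun h' => h'.2.1⟩
        by_cases hzK : z ∈ K
        exacts [Or.inl hzK, Or.inr ⟨hz, h, hzK⟩]

theorem propositionP :
    ∃ G : Set ℕ, IsDelta ∅ 3 G ∧
      ∀ I : TuringIdeal, I.carrier = principal G →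
        ∀ n : ℕ, 3 ≤ n →
          ¬ I.IsGenericallyCoded n ∧ ∃ H : Set ℕ, I.IsGeneric n H ∧ ¬ G ≤ₛ H := by
  obtain ⟨G, hΔ, hinf, hG⟩ := exists_isDelta_three_generic
  refine ⟨G, hΔ, fun I hI n _ => ?_⟩
  have hmem : ∀ S : Set ℕ, S ∈ I.carrier ↔ S ≤ₛ G := fun S => by rw [hI]; rfl
  have hGI : G ∈ I.carrier := (hmem G).2 (TuringReducible.refl _)
  -- Working below `(∅, G)` makes every reservoir a subset of `G`, as `exists_extension_avoiding`
  -- demands.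
  have h₀ : ((∅, G) : Finset ℕ × Set ℕ) ∈ I.conditions := by
    refine ⟨⟨Set.infinite_of_forall_exists_gt fun m => ?_, by simp⟩, hGI⟩
    obtain ⟨z, hz, hzG⟩ := hinf (m + 1)
    exact ⟨z, hzG, hz⟩
  have key : ∃ H : Set ℕ, I.IsGeneric n H ∧ ¬ G ≤ₛ H := by
    refine I.exists_isGeneric_not_setReducible h₀ (fun j => ?_) n
    rintro ⟨K, S⟩ ⟨hc, hS⟩ hext
    have hSG : S ⊆ G := hext.2.2
    have hSred := (hmem S).1 hS
    obtain ⟨i, hi⟩ := exists_turingFunctional hSred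
    obtain ⟨D, R, hDG, hGR, hreq⟩ := hG (i, j, K.toList)
    obtain ⟨F, k, hFS, hk, hav⟩ := exists_extension_avoiding hSG hc hi hDG hGR hreq
    refine ⟨(K ∪ F, tailFrom S k), ⟨⟨?_, fun d hd z hz => (hk d hd).trans_le hz.2⟩,
      (hmem _).2 (hSred.tailFrom k)⟩, ⟨Finset.subset_union_left, ?_, fun z hz => hz.1⟩, hav⟩
    · refine Set.infinite_of_forall_exists_gt fun m => ?_
      obtain ⟨z, hz, hzm⟩ := hc.1.exists_gt (max m k)
      exact ⟨z, ⟨hz, (le_max_right _ _).trans hzm.le⟩, (le_max_left _ _).trans_lt hzm⟩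
    · rw [Finset.coe_union]
      exact Set.union_subset_union_right _ hFS
  refine ⟨fun hcode => ?_, key⟩
  obtain ⟨H, hH, hGH⟩ := key
  exact hGH (hcode H hH G hGI)
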